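/- **Setting.** Let $\mathcal X\subset\mathbb R^d$ be open and let $dx$ be Lebesgue measure on it. Let $\Theta\subset\mathbb R$, let $\theta_0$ be an interior point of $\Theta$, and let $\mathcal P=(P_\theta)_{\theta\in\Theta}$ be a family of probability measures on $\mathcal X$ with densities $p_\theta=dP_\theta/dx$. A model with densities $p_\theta$ with respect to a dominating measure $\nu$ is differentiable in quadratic mean (DQM) at $\theta_0$ with score $s_{\theta_0}$ if $s_{\theta_0}$ is measurable and $\int\big(\sqrt{p_{\theta_0+h}}-\sqrt{p_{\theta_0}}-\tfrac12 h\,s_{\theta_0}\sqrt{p_{\theta_0}}\big)^2d\nu=o(h^2)$ as $h\to0$; its Fisher information is then $\mathcal I_{\theta_0}=\mathbb E_{\theta_0}[s_{\theta_0}^2]$. Assume that $\mathcal P$ is DQM at $\theta_0$ with respect to $dx$, with score $s_{\theta_0}$. Let $\alpha>0$. Let $B$ be the set of (a.e. classes of) measurable $v:\mathcal X\to\mathbb R$ with $1\le v\le e^\alpha$ a.e., with the weak-$\star$ topology of $L^\infty=(L^1)^*$ and its Borel $\sigma$-algebra, and let $\mathcal E\subset B$ be the set of those $r$ with $r(x)\in\{1,e^\alpha\}$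 for a.e. $x$. For $r\in\mathcal E$ put $F_r^+=\{x: r(x)=e^\alpha\}$. Let $(x,r)\mapsto e_x(r)$ be a jointly measurable evaluation map with, for each $r\in B$, $e_x(r)=r(x)$ for a.e. $x$; concretely, $e_x(r)=\limsup_{n\to\infty}$ of the averages of $r$ over $\{y\in\mathcal X:|y-x|\le 1/n\}$. For $r\in B$ let $T(r)=e^\alpha+1-r$ and $$i(r)=\frac{\left(\int_{\mathcal X}s_{\theta_0}(x)r(x)p_{\theta_0}(x)\,dx\right)^2}{\int_{\mathcal X}r(x)p_{\theta_0}(x)\,dx},\qquad i^{(s)}(r)=\tfrac12\left[i(r)+i(T(r))\right].$$ A Radon sub-probability measure $\mu$ on $\mathcal E$ is called normalized if $\int_{\mathcal E}e_x(r)\,\mu(dr)=1$ for a.e. $x\in\mathcal X$; it defines the mechanism $q^{(\mu)}(x,dr)=e_x(r)\,\mu(dr)$. Let $I^*$ be the supremum of $\int_{\mathcal E}i(r)\,\mu(dr)$ over all normalized Radon sub-probability measures $\mu$ on $\mathcal E$. Let $\mathcal J^{\max,\alpha}_{\theta_0}$ be the maximal Fisher information at $\theta_0$ of the privatized models $Q\circ\mathcal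 P=(Q\circ P_\theta)_{\theta\in\Theta}$, where $Q$ runs through all Markov kernels from $\mathcal X$ to a Polish space that satisfy $Q(A\mid x)\le e^\alpha Q(A\mid x')$ for all $x,x'\in\mathcal X$ and all measurable $A$. **Theorem.** Suppose that $\bar\mu$ is a normalized Radon sub-probability measure on $\mathcal E$ that attains $I^*$ and is symmetric, i.e. invariant under $T$. Then: 1. The function $r\mapsto i^{(s)}(r)$ is $\bar\mu$-almost everywhere constant. 2. The maximum of $i^{(s)}$ over $B$ exists, the maximum $\mathcal J^{\max,\alpha}_{\theta_0}$ exists, and $$\mathcal J^{\max,\alpha}_{\theta_0}=\mathcal I_{\theta_0}\big(q^{(\bar\mu)}\circ\mathcal P\big)=I^*=\frac{2}{e^\alpha+1}\,\max_{r\in B}i^{(s)}(r).$$ 3. For every $r\in\mathcal E$, $$i^{(s)}(r)=\frac{(e^\alpha-1)^2(e^\alpha+1)}{2}\cdot\frac{\left(\int_{F_r^+}s_{\theta_0}(x)p_{\theta_0}(x)\,dx\right)^2}{\left(e^\alpha-(e^\alpha-1)\int_{F_r^+}p_{\theta_0}(x)\,dx\right)\left(1+(e^\alpha-1)\int_{F_r^+}p_{\theta_0}(x)\,dx\right)}.$$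 -/

import Mathlib

open MeasureTheory ProbabilityTheory Filter Topology

noncomputable section

/-! ### Statistical models, differentiability in quadratic mean, Fisher information -/

/-- The (real-valued) density `dP/dν`. -/
def modelDensity {Y : Type} [MeasurableSpace Y] (ν P : Measure Y) (y : Y) : ℝ :=
  (P.rnDeriv ν y).toReal

/-- The one-parameter model `P`, dominated by `ν`, is differentiable in quadratic mean at `θ₀`
with score `s`: with `p_θ = dP_θ/dν`,
`∫ (√p_{θ₀+h} - √p_{θ₀} - (1/2) h s √p_{θ₀})² dν = o(h²)` as `h → 0`. -/
def IsDQMScore {Y : Type} [MeasurableSpace Y] (ν : Measure Y) (P : ℝ → Measure Y) (θ₀ : ℝ)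
    (s : Y → ℝ) : Prop :=
  Measurable s ∧
    Tendsto
      (fun h : ℝ =>
        (∫⁻ y, ENNReal.ofReal
          ((√(modelDensity ν (P (θ₀ + h)) y) - √(modelDensity ν (P θ₀) y)
            - (1 / 2) * h * s y * √(modelDensity ν (P θ₀) y)) ^ 2) ∂ν) / ENNReal.ofReal (h ^ 2))
      (𝓝[≠] 0) (𝓝 0)

/-- The model `(P_θ)_{θ ∈ Θ}` is dominated and differentiable in quadratic mean at `θ₀`, and its
Fisher information `E_{θ₀}[t²]`, with `t` the score at `θ₀`, is `I`. -/
def HasFisherInfo {Y : Type} [MeasurableSpace Y] (Θ : Set ℝ) (P : ℝ → Measure Y) (θ₀ I : ℝ) :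
    Prop :=
  ∃ ν : Measure Y, SigmaFinite ν ∧ (∀ θ ∈ Θ, P θ ≪ ν) ∧
    ∃ t : Y → ℝ, IsDQMScore ν P θ₀ t ∧ I = ∫ y, t y ^ 2 ∂(P θ₀)

/-! ### Local differential privacy -/

/-- `Q(A | x) ≤ e^α Q(A | x')` for all `x`, `x'` and all measurable `A`. -/
def IsLDP {𝒳 Z : Type} [MeasurableSpace 𝒳] [MeasurableSpace Z] (α : ℝ) (Q : Kernel 𝒳 Z) : Prop :=
  ∀ x x' : 𝒳, ∀ A : Set Z, MeasurableSet A → Q x A ≤ ENNReal.ofReal (Real.exp α) * Q x' A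

/-- The Fisher informations at `θ₀` of the privatized models `(Q ∘ P_θ)_{θ ∈ Θ}`, where `Q` runs
through all `α`-locally differentially private Markov kernels from the data space to a Polish
space. Its maximum is the maximal Fisher information under `α`-LDP. -/
def privateFisherInfos {𝒳 : Type} [MeasurableSpace 𝒳] (α : ℝ) (Θ : Set ℝ) (P : ℝ → Measure 𝒳)
    (θ₀ : ℝ) : Set ℝ :=
  {I | ∃ (Z : Type) (_ : TopologicalSpace Z) (_ : PolishSpace Z) (_ : MeasurableSpace Z)
      (_ : BorelSpace Z) (Q : Kernel 𝒳 Z) (_ : IsMarkovKernel Q),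
      IsLDP α Q ∧ HasFisherInfo Θ (fun θ => (P θ).bind Q) θ₀ I}

/-! ### The sets `B` and `𝓔` -/

/-- The set `B` of (a.e. classes of) measurable functions `v` with `1 ≤ v ≤ e^α` a.e. -/
structure StairBox {𝒳 : Type} [MeasurableSpace 𝒳] (lam : Measure 𝒳) (α : ℝ) where
  toFun : 𝒳 →ₘ[lam] ℝ
  bounds : ∀ᵐ x ∂lam, 1 ≤ toFun x ∧ toFun x ≤ Real.exp α

/-- The weak-star topology of `L^∞ = (L¹)*` on `B`. -/
instance StairBox.instTopologicalSpace {𝒳 : Type} [MeasurableSpace 𝒳] (lam : Measure 𝒳) (α : ℝ) :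
    TopologicalSpace (StairBox lam α) :=
  ⨅ f : Lp ℝ 1 lam,
    TopologicalSpace.induced (fun v : StairBox lam α => ∫ x, f x * v.toFun x ∂lam) inferInstance

instance StairBox.instMeasurableSpace {𝒳 : Type} [MeasurableSpace 𝒳] (lam : Measure 𝒳) (α : ℝ) :
    MeasurableSpace (StairBox lam α) :=
  borel (StairBox lam α)

/-- The set `𝓔` of the elements of `B` with values in `{1, e^α}` a.e. It carries the topology and
the Borel σ-algebra of a subspace of `B`. -/
def stairExtremal {𝒳 : Type} [MeasurableSpace 𝒳] (lam : Measure 𝒳) (α : ℝ) :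
    Set (StairBox lam α) :=
  {r | ∀ᵐ x ∂lam, r.toFun x = 1 ∨ r.toFun x = Real.exp α}

theorem stairSwap_coeFn {𝒳 : Type} [MeasurableSpace 𝒳] {lam : Measure 𝒳} (α : ℝ)
    (f : 𝒳 →ₘ[lam] ℝ) :
    ∀ᵐ x ∂lam, (AEEqFun.const 𝒳 (Real.exp α + 1) - f : 𝒳 →ₘ[lam] ℝ) x
      = Real.exp α + 1 - f x := by
  filter_upwards [AEEqFun.coeFn_sub (AEEqFun.const 𝒳 (Real.exp α + 1)) f,
    AEEqFun.coeFn_const (μ := lam) (α := 𝒳) (Real.exp α + 1)] with x h1 h2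
  rw [h1, Pi.sub_apply, h2, Function.const_apply]

/-- `T(r) = e^α + 1 - r` on `B`. -/
def stairSwap {𝒳 : Type} [MeasurableSpace 𝒳] {lam : Measure 𝒳} {α : ℝ} (r : StairBox lam α) :
    StairBox lam α where
  toFun := AEEqFun.const 𝒳 (Real.exp α + 1) - r.toFun
  bounds := by
    filter_upwards [stairSwap_coeFn α r.toFun, r.bounds] with x h1 h2
    rw [h1]
    constructor <;> linarith [h2.1, h2.2]

theorem stairSwap_mem {𝒳 : Type} [MeasurableSpace 𝒳] {lam : Measure 𝒳} {α : ℝ}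
    {r : StairBox lam α} (hr : r ∈ stairExtremal lam α) : stairSwap r ∈ stairExtremal lam α := by
  have hr' : ∀ᵐ x ∂lam, r.toFun x = 1 ∨ r.toFun x = Real.exp α := hr
  change ∀ᵐ x ∂lam, (stairSwap r).toFun x = 1 ∨ (stairSwap r).toFun x = Real.exp α
  filter_upwards [stairSwap_coeFn α r.toFun, hr'] with x h1 h2
  change (AEEqFun.const 𝒳 (Real.exp α + 1) - r.toFun : 𝒳 →ₘ[lam] ℝ) x = 1 ∨
    (AEEqFun.const 𝒳 (Real.exp α + 1) - r.toFun : 𝒳 →ₘ[lam] ℝ) x = Real.exp α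
  rw [h1]
  rcases h2 with h | h <;> rw [h]
  · right; ring
  · left; ring

/-- `T : 𝓔 → 𝓔`. -/
def stairSwapE {𝒳 : Type} [MeasurableSpace 𝒳] {lam : Measure 𝒳} {α : ℝ}
    (r : stairExtremal lam α) : stairExtremal lam α :=
  ⟨stairSwap r.1, stairSwap_mem r.2⟩

/-- The evaluation operator `(x, r) ↦ e_x(r)`, a version of `r(x)` that depends only on the a.e.
class of `r`: the upper limit of the averages of `r` over shrinking balls around `x`. On an open
subset of `ℝ^d` with Lebesgue measure it equals `r(x)` for a.e. `x`. -/
def stairEval {𝒳 : Type} [MeasurableSpace 𝒳] [PseudoMetricSpace 𝒳] {lam : Measure 𝒳} {α : ℝ}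
    (x : 𝒳) (r : StairBox lam α) : ℝ :=
  limsup (fun n : ℕ => ⨍ y in Metric.closedBall x (1 / ((n : ℝ) + 1)), r.toFun y ∂lam) atTop

/-! ### The optimization problem -/

/-- Radon sub-probability measures `μ` on `𝓔` with `∫ e_x(r) μ(dr) = 1` for a.e. `x`. -/
structure IsStairNormalized {𝒳 : Type} [MeasurableSpace 𝒳] [PseudoMetricSpace 𝒳]
    {lam : Measure 𝒳} {α : ℝ} (μ : Measure (stairExtremal lam α)) : Prop where
  subprob : μ Set.univ ≤ 1
  radon : μ.InnerRegular
  normalized : ∀ᵐ x ∂lam, ∫ r : stairExtremal lam α, stairEval x r.1 ∂μ = 1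

/-- `i(r) = (∫ s r p dx)² / ∫ r p dx` for `r ∈ B`. -/
def stairInfo {𝒳 : Type} [MeasurableSpace 𝒳] {lam : Measure 𝒳} {α : ℝ} (s p : 𝒳 → ℝ)
    (r : StairBox lam α) : ℝ :=
  (∫ x, s x * r.toFun x * p x ∂lam) ^ 2 / ∫ x, r.toFun x * p x ∂lam

/-- `i^{(s)}(r) = (i(r) + i(T r)) / 2` for `r ∈ B`. -/
def stairInfoSym {𝒳 : Type} [MeasurableSpace 𝒳] {lam : Measure 𝒳} {α : ℝ} (s p : 𝒳 → ℝ)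
    (r : StairBox lam α) : ℝ :=
  (1 / 2) * (stairInfo s p r + stairInfo s p (stairSwap r))

/-- The values `∫ i(r) μ(dr)` of the optimization problem. -/
def stairObjectives {𝒳 : Type} [MeasurableSpace 𝒳] [PseudoMetricSpace 𝒳] (lam : Measure 𝒳)
    (α : ℝ) (s p : 𝒳 → ℝ) : Set ℝ :=
  {J | ∃ μ : Measure (stairExtremal lam α), IsStairNormalized μ ∧ J = ∫ r, stairInfo s p r.1 ∂μ}

/-- `μ` solves the optimization problem. -/
def IsStairMaximizer {𝒳 : Type} [MeasurableSpace 𝒳] [PseudoMetricSpace 𝒳] {lam : Measure 𝒳}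
    {α : ℝ} (s p : 𝒳 → ℝ) (μ : Measure (stairExtremal lam α)) : Prop :=
  IsStairNormalized μ ∧
    ∀ μ' : Measure (stairExtremal lam α), IsStairNormalized μ' →
      ∫ r, stairInfo s p r.1 ∂μ' ≤ ∫ r, stairInfo s p r.1 ∂μ

/-- The law of the public variable under the staircase mechanism `q^{(μ)}(x, dr) = e_x(r) μ(dr)`
when the private variable has law `P`, i.e. `(∫ e_x(r) P(dx)) μ(dr)`. -/
def stairPublicLaw {𝒳 : Type} [MeasurableSpace 𝒳] [PseudoMetricSpace 𝒳] {lam : Measure 𝒳}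
    {α : ℝ} (μ : Measure (stairExtremal lam α)) (P : Measure 𝒳) :
    Measure (stairExtremal lam α) :=
  μ.withDensity (fun r => ∫⁻ x, ENNReal.ofReal (stairEval x r.1) ∂P)

/-- The level set `F_r^+ = r⁻¹({e^α})`. -/
def stairLevel {𝒳 : Type} [MeasurableSpace 𝒳] {lam : Measure 𝒳} {α : ℝ} (r : StairBox lam α) :
    Set 𝒳 :=
  {x | r.toFun x = Real.exp α}

/-- Lebesgue measure `dx` on a subset `X` of `ℝ^d`. -/
def lebesgueOn {d : ℕ} (X : Set (EuclideanSpace ℝ (Fin d))) : Measure X :=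
  (volume : Measure (EuclideanSpace ℝ (Fin d))).comap Subtype.val

end

/-!
A public outcome with conditional probability `u` given the private value contributes
`(∫ s u dP_{θ₀})² / ∫ u dP_{θ₀}` to the Fisher information, and this contribution is subadditive
and positively homogeneous in `u`. Under local differential privacy every outcome has, up to a
factor, `1 ≤ u ≤ e^α`, hence is a mixture of functions with values in `{1, e^α}`; splitting each
outcome accordingly turns a finite quantization of any private mechanism into a staircase mechanism
which is at least as informative, so that private Fisher informations are bounded by `I^*`.
Conversely, every `r ∈ B` defines a private mechanism with the two outcome densities `r` and `T r`,
whose Fisher information is `2 / (e^α + 1) * i^{(s)}(r)`. Therefore `i^{(s)} ≤ (e^α + 1) / 2 * I^*`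
on `B`. Since `e_x(r) + e_x(T r) ≥ e^α + 1` for every `x`, a symmetric maximizer has mass at most
`2 / (e^α + 1)`, while its integral of `i^{(s)}` is `I^*`; so the bound is attained almost
everywhere.
-/

/-! ### Differentiability in quadratic mean -/

section DQM

variable {Y : Type} [MeasurableSpace Y]

theorem modelDensity_nonneg (ν P : Measure Y) (y : Y) : 0 ≤ modelDensity ν P y :=
  ENNReal.toReal_nonneg

theorem measurable_modelDensity (ν P : Measure Y) : Measurable (modelDensity ν P) :=
  (Measure.measurable_rnDeriv P ν).ennreal_toReal

theorem integrable_modelDensity (ν P : Measure Y) [IsFiniteMeasure P] :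
    Integrable (modelDensity ν P) ν :=
  Measure.integrable_toReal_rnDeriv

theorem integral_mul_modelDensity {ν P : Measure Y} [SigmaFinite ν] [SigmaFinite P]
    (h : P ≪ ν) (f : Y → ℝ) : ∫ y, f y * modelDensity ν P y ∂ν = ∫ y, f y ∂P := by
  simpa only [modelDensity, mul_comm] using integral_toReal_rnDeriv_mul h (f := f)

theorem integrable_mul_modelDensity_iff {ν P : Measure Y} [SigmaFinite ν] [SigmaFinite P]
    (h : P ≪ ν) {f : Y → ℝ} :
    Integrable (fun y => f y * modelDensity ν P y) ν ↔ Integrable f P := by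
  rw [← integrable_rnDeriv_smul_iff h]
  simp only [smul_eq_mul, modelDensity, mul_comm]

theorem modelDensity_withDensity_ofReal (ν : Measure Y) [SigmaFinite ν] {f : Y → ℝ}
    (hf : AEMeasurable f ν) (hf0 : 0 ≤ᵐ[ν] f) :
    modelDensity ν (ν.withDensity fun y => ENNReal.ofReal (f y)) =ᵐ[ν] f := by
  filter_upwards [Measure.rnDeriv_withDensity₀ ν hf.ennreal_ofReal, hf0] with y hy hy0
  rw [modelDensity, hy, ENNReal.toReal_ofReal hy0]

/-- The measures `P θ` with `θ` close to `θ₀` are probability measures dominated by `ν`. -/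
def IsDominatedNear (ν : Measure Y) (P : ℝ → Measure Y) (θ₀ : ℝ) : Prop :=
  ∀ᶠ θ in 𝓝 θ₀, IsProbabilityMeasure (P θ) ∧ P θ ≪ ν

/-- The remainder `√p_{θ₀+h} - √p_{θ₀} - (1/2) h s √p_{θ₀}` in the definition of differentiability
in quadratic mean. -/
noncomputable def dqmRemainder (ν : Measure Y) (P : ℝ → Measure Y) (θ₀ : ℝ) (s : Y → ℝ) (h : ℝ)
    (y : Y) : ℝ :=
  √(modelDensity ν (P (θ₀ + h)) y) - √(modelDensity ν (P θ₀) y)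
    - (1 / 2) * h * s y * √(modelDensity ν (P θ₀) y)

variable {ν : Measure Y} {P : ℝ → Measure Y} {θ₀ : ℝ} {s : Y → ℝ}

theorem isDominatedNear_of_mem_interior {Θ : Set ℝ} (hθ₀ : θ₀ ∈ interior Θ)
    (hP : ∀ θ ∈ Θ, IsProbabilityMeasure (P θ)) (hdom : ∀ θ ∈ Θ, P θ ≪ ν) :
    IsDominatedNear ν P θ₀ := by
  filter_upwards [mem_interior_iff_mem_nhds.1 hθ₀] with θ hθ
  exact ⟨hP θ hθ, hdom θ hθ⟩

theorem eventually_nhds_add {p : ℝ → Prop} {a : ℝ} (h : ∀ᶠ x in 𝓝 a, p x) :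
    ∀ᶠ t in 𝓝 0, p (a + t) := by
  have hadd : Tendsto (a + ·) (𝓝 0) (𝓝 a) := by
    simpa only [add_zero] using (continuous_const_add a).tendsto 0
  exact hadd.eventually h

theorem measurable_dqmRemainder (hs : Measurable s) (h : ℝ) :
    Measurable (dqmRemainder ν P θ₀ s h) := by
  have h1 := measurable_modelDensity ν (P (θ₀ + h))
  have h2 := measurable_modelDensity ν (P θ₀)
  unfold dqmRemainder
  fun_prop

theorem IsDQMScore.eventually_remainder (hs : IsDQMScore ν P θ₀ s) {δ : ℝ} (hδ : 0 < δ) :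
    ∀ᶠ h in 𝓝[≠] (0 : ℝ), Integrable (fun y => dqmRemainder ν P θ₀ s h y ^ 2) ν ∧
      ∫ y, dqmRemainder ν P θ₀ s h y ^ 2 ∂ν ≤ δ * h ^ 2 := by
  filter_upwards [hs.2.eventually (gt_mem_nhds (ENNReal.ofReal_pos.2 hδ)),
    self_mem_nhdsWithin] with h hlt h0
  have hle : ∫⁻ y, ENNReal.ofReal (dqmRemainder ν P θ₀ s h y ^ 2) ∂ν
      ≤ ENNReal.ofReal (δ * h ^ 2) := by
    rw [ENNReal.ofReal_mul hδ.le]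
    exact (ENNReal.div_le_iff (ENNReal.ofReal_pos.2 (sq_pos_iff.2 h0)).ne'
      ENNReal.ofReal_ne_top).1 hlt.le
  have hnonneg : 0 ≤ᵐ[ν] fun y => dqmRemainder ν P θ₀ s h y ^ 2 := .of_forall fun y => sq_nonneg _
  have hmeas : AEStronglyMeasurable (fun y => dqmRemainder ν P θ₀ s h y ^ 2) ν :=
    ((measurable_dqmRemainder hs.1 h).pow_const 2).aestronglyMeasurable
  refine ⟨⟨hmeas, ?_⟩, ?_⟩
  · rw [hasFiniteIntegral_iff_ofReal hnonneg]
    exact hle.trans_lt ENNReal.ofReal_lt_top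
  · rw [integral_eq_lintegral_of_nonneg_ae hnonneg hmeas]
    exact ENNReal.toReal_le_of_le_ofReal (by positivity) hle

theorem sq_mul_modelDensity_le {h : ℝ} (h0 : h ≠ 0) (y : Y) :
    s y ^ 2 * modelDensity ν (P θ₀) y ≤ 12 / h ^ 2 * (modelDensity ν (P (θ₀ + h)) y
      + modelDensity ν (P θ₀) y + dqmRemainder ν P θ₀ s h y ^ 2) := by
  rw [div_mul_eq_mul_div, le_div_iff₀ (by positivity), dqmRemainder,
    ← Real.sq_sqrt (modelDensity_nonneg ν (P θ₀) y),
    ← Real.sq_sqrt (modelDensity_nonneg ν (P (θ₀ + h)) y), Real.sqrt_sq (Real.sqrt_nonneg _),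
    Real.sqrt_sq (Real.sqrt_nonneg _)]
  generalize √(modelDensity ν (P (θ₀ + h)) y) = a
  generalize √(modelDensity ν (P θ₀) y) = b
  have sq_sub_sub_le (u v w : ℝ) : (u - v - w) ^ 2 ≤ 3 * (u ^ 2 + v ^ 2 + w ^ 2) := by
    nlinarith [sq_nonneg (u + v), sq_nonneg (u + w), sq_nonneg (v - w)]
  linarith [sq_sub_sub_le a b (a - b - 1 / 2 * h * s y * b)]

theorem abs_sq_sub_sq_sub_le (a b h t : ℝ) {c : ℝ} (hc : 0 < c) :
    |a ^ 2 - b ^ 2 - h * (t * b ^ 2)|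
      ≤ (1 / c + 2) * (a - b - 1 / 2 * h * t * b) ^ 2 + c * b ^ 2
        + h ^ 2 / 2 * (t ^ 2 * b ^ 2) := by
  set ρ := a - b - 1 / 2 * h * t * b with hρ
  have expand : a ^ 2 - b ^ 2 - h * (t * b ^ 2) = 2 * (ρ * b) + (ρ + 1 / 2 * h * t * b) ^ 2 := by
    rw [hρ]; ring
  have cross : |2 * (ρ * b)| ≤ 1 / c * ρ ^ 2 + c * b ^ 2 := by
    have expand_add : 1 / c * (ρ + c * b) ^ 2 = 1 / c * ρ ^ 2 + c * b ^ 2 + 2 * (ρ * b) := by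
      field_simp; ring
    have expand_sub : 1 / c * (ρ - c * b) ^ 2 = 1 / c * ρ ^ 2 + c * b ^ 2 - 2 * (ρ * b) := by
      field_simp; ring
    have nonneg_add : 0 ≤ 1 / c * (ρ + c * b) ^ 2 := by positivity
    have nonneg_sub : 0 ≤ 1 / c * (ρ - c * b) ^ 2 := by positivity
    rw [abs_le]
    constructor <;> linarith
  have square : (ρ + 1 / 2 * h * t * b) ^ 2 ≤ 2 * ρ ^ 2 + h ^ 2 / 2 * (t ^ 2 * b ^ 2) := by
    linarith [sq_nonneg (ρ - 1 / 2 * h * t * b)]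
  calc _ ≤ |2 * (ρ * b)| + |(ρ + 1 / 2 * h * t * b) ^ 2| := expand ▸ abs_add_le _ _
    _ ≤ _ := by rw [abs_of_nonneg (sq_nonneg (ρ + _))]; linarith

theorem abs_modelDensity_sub_le (h : ℝ) {c : ℝ} (hc : 0 < c) (y : Y) :
    |modelDensity ν (P (θ₀ + h)) y - modelDensity ν (P θ₀) y - h * (s y * modelDensity ν (P θ₀) y)|
      ≤ (1 / c + 2) * dqmRemainder ν P θ₀ s h y ^ 2 + c * modelDensity ν (P θ₀) y
        + h ^ 2 / 2 * (s y ^ 2 * modelDensity ν (P θ₀) y) := by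
  have key := abs_sq_sub_sq_sub_le (√(modelDensity ν (P (θ₀ + h)) y))
    (√(modelDensity ν (P θ₀) y)) h (s y) hc
  rwa [Real.sq_sqrt (modelDensity_nonneg _ _ _), Real.sq_sqrt (modelDensity_nonneg _ _ _)] at key

variable [SigmaFinite ν]

theorem IsDQMScore.integrable_sq (hs : IsDQMScore ν P θ₀ s) (hP : IsDominatedNear ν P θ₀) :
    Integrable (fun y => s y ^ 2) (P θ₀) := by
  obtain ⟨hprob, hdom⟩ := hP.self_of_nhds
  obtain ⟨h, ⟨hρ, -⟩, ⟨hprob', -⟩, h0⟩ := ((hs.eventually_remainder one_pos).and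
    ((eventually_nhdsWithin_of_eventually_nhds (eventually_nhds_add hP)).and
      self_mem_nhdsWithin)).exists
  have hbound : Integrable (fun y => 12 / h ^ 2 * (modelDensity ν (P (θ₀ + h)) y
      + modelDensity ν (P θ₀) y + dqmRemainder ν P θ₀ s h y ^ 2)) ν :=
    (((integrable_modelDensity ν _).add (integrable_modelDensity ν _)).add hρ).const_mul _
  rw [← integrable_mul_modelDensity_iff hdom]
  refine hbound.mono' ((hs.1.pow_const 2).mul (measurable_modelDensity _ _)).aestronglyMeasurable
    (.of_forall fun y => ?_)
  rw [Real.norm_of_nonneg (mul_nonneg (sq_nonneg _) (modelDensity_nonneg _ _ _))]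
  exact sq_mul_modelDensity_le h0 y

theorem IsDQMScore.integrable (hs : IsDQMScore ν P θ₀ s) (hP : IsDominatedNear ν P θ₀) :
    Integrable s (P θ₀) := by
  have := hP.self_of_nhds.1
  exact ((memLp_two_iff_integrable_sq hs.1.aestronglyMeasurable).2
    (hs.integrable_sq hP)).integrable one_le_two

theorem IsDQMScore.integral_abs_modelDensity_sub_le (hs : IsDQMScore ν P θ₀ s)
    (hP : IsDominatedNear ν P θ₀) {h : ℝ}
    (hρ : Integrable (fun y => dqmRemainder ν P θ₀ s h y ^ 2) ν) {c : ℝ} (hc : 0 < c) :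
    ∫ y, |modelDensity ν (P (θ₀ + h)) y - modelDensity ν (P θ₀) y
        - h * (s y * modelDensity ν (P θ₀) y)| ∂ν
      ≤ (1 / c + 2) * (∫ y, dqmRemainder ν P θ₀ s h y ^ 2 ∂ν) + c
        + h ^ 2 / 2 * ∫ y, s y ^ 2 ∂P θ₀ := by
  obtain ⟨hprob, hdom⟩ := hP.self_of_nhds
  have hp := integrable_modelDensity ν (P θ₀)
  have hsp := (integrable_mul_modelDensity_iff hdom).2 (hs.integrable_sq hP)
  have hp1 : ∫ y, modelDensity ν (P θ₀) y ∂ν = 1 := by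
    simpa using integral_mul_modelDensity hdom fun _ => (1 : ℝ)
  have hρp : Integrable (fun y => (1 / c + 2) * dqmRemainder ν P θ₀ s h y ^ 2
      + c * modelDensity ν (P θ₀) y) ν := (hρ.const_mul _).add (hp.const_mul _)
  calc _ ≤ ∫ y, ((1 / c + 2) * dqmRemainder ν P θ₀ s h y ^ 2 + c * modelDensity ν (P θ₀) y
        + h ^ 2 / 2 * (s y ^ 2 * modelDensity ν (P θ₀) y)) ∂ν :=
        integral_mono_of_nonneg (.of_forall fun y => abs_nonneg _) (hρp.add (hsp.const_mul _))
          (.of_forall (abs_modelDensity_sub_le h hc))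
    _ = _ := by
        rw [integral_add hρp (hsp.const_mul _), integral_add (hρ.const_mul _) (hp.const_mul _),
          integral_const_mul, integral_const_mul, integral_const_mul, hp1, mul_one,
          integral_mul_modelDensity hdom]

theorem IsDQMScore.eventually_integral_abs_modelDensity_sub_le (hs : IsDQMScore ν P θ₀ s)
    (hP : IsDominatedNear ν P θ₀) {ε : ℝ} (hε : 0 < ε) :
    ∀ᶠ h in 𝓝 (0 : ℝ), ∫ y, |modelDensity ν (P (θ₀ + h)) y - modelDensity ν (P θ₀) y
      - h * (s y * modelDensity ν (P θ₀) y)| ∂ν ≤ ε * |h| := by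
  set K := ∫ y, s y ^ 2 ∂P θ₀
  have hsmall : ∀ᶠ h in 𝓝 (0 : ℝ), |h| * (ε ^ 2 / 8 + K / 2) ≤ ε / 2 := by
    have hcont : Continuous fun h : ℝ => |h| * (ε ^ 2 / 8 + K / 2) := by fun_prop
    exact hcont.tendsto' 0 0 (by simp) |>.eventually (ge_mem_nhds (half_pos hε))
  filter_upwards [hsmall, eventually_nhdsWithin_iff.1
    (hs.eventually_remainder (δ := ε ^ 2 / 16) (by positivity))] with h hh hrem
  rcases eq_or_ne h 0 with rfl | h0
  · simp
  obtain ⟨hint, hle⟩ := hrem h0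
  have : 0 < |h| := abs_pos.2 h0
  calc _ ≤ (1 / (ε / 4 * |h|) + 2) * (∫ y, dqmRemainder ν P θ₀ s h y ^ 2 ∂ν) + ε / 4 * |h|
        + h ^ 2 / 2 * K := hs.integral_abs_modelDensity_sub_le hP hint (by positivity)
    _ ≤ (1 / (ε / 4 * |h|) + 2) * (ε ^ 2 / 16 * h ^ 2) + ε / 4 * |h| + h ^ 2 / 2 * K := by gcongr
    _ = ε / 2 * |h| + |h| * (ε ^ 2 / 8 + K / 2) * |h| := by
        rw [← sq_abs h]; field_simp; ring
    _ ≤ ε / 2 * |h| + ε / 2 * |h| := by gcongr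
    _ = ε * |h| := by ring

end DQM

/-! ### Uniform differentiability -/

section UniformDeriv

variable {ι : Type*} {f : ℝ → ι → ℝ} {g : ι → ℝ} {θ₀ : ℝ}

/-- The functions `θ ↦ f θ i` are differentiable at `θ₀` with derivatives `g i`, uniformly
in `i`. -/
def HasUniformDerivAt (f : ℝ → ι → ℝ) (g : ι → ℝ) (θ₀ : ℝ) : Prop :=
  ∀ ε > 0, ∀ᶠ h in 𝓝 (0 : ℝ), ∀ i, |f (θ₀ + h) i - f θ₀ i - h * g i| ≤ ε * |h|

theorem HasUniformDerivAt.hasDerivAt (hf : HasUniformDerivAt f g θ₀) (i : ι) :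
    HasDerivAt (fun θ => f θ i) (g i) θ₀ := by
  rw [hasDerivAt_iff_isLittleO_nhds_zero, Asymptotics.isLittleO_iff]
  intro ε hε
  filter_upwards [hf ε hε] with h hh using hh i

theorem HasUniformDerivAt.eventually_abs_sub_le (hf : HasUniformDerivAt f g θ₀) {C : ℝ}
    (hgC : ∀ i, |g i| ≤ C) :
    ∀ᶠ h in 𝓝 (0 : ℝ), ∀ i, |f (θ₀ + h) i - f θ₀ i| ≤ (C + 1) * |h| := by
  filter_upwards [hf 1 one_pos] with h hh i
  calc _ ≤ |f (θ₀ + h) i - f θ₀ i - h * g i| + |h * g i| := by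
        simpa only [sub_add_cancel] using abs_add_le (f (θ₀ + h) i - f θ₀ i - h * g i) (h * g i)
    _ ≤ 1 * |h| + |h| * C := by rw [abs_mul h]; gcongr; exacts [hh i, hgC i]
    _ = _ := by ring

theorem abs_sqrt_sub_sqrt_sub_le {a b : ℝ} (ha : 0 < a) (hb : 0 ≤ b) (t : ℝ) :
    |√b - √a - t / (2 * √a)| ≤ (|b - a - t| + (b - a) ^ 2 / a) / (2 * √a) := by
  have hA : 0 < √a := Real.sqrt_pos.2 ha
  have hB : 0 ≤ √b := Real.sqrt_nonneg b
  rw [← Real.sq_sqrt ha.le, ← Real.sq_sqrt hb, Real.sqrt_sq hA.le, Real.sqrt_sq hB]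
  generalize √a = A at *
  generalize √b = B at *
  have taylor : B - A - t / (2 * A) = (B ^ 2 - A ^ 2 - t - (B - A) ^ 2) / (2 * A) := by
    field_simp; ring
  have hsq : (B - A) ^ 2 ≤ (B ^ 2 - A ^ 2) ^ 2 / A ^ 2 := by
    rw [le_div_iff₀ (by positivity)]
    calc (B - A) ^ 2 * A ^ 2 ≤ (B - A) ^ 2 * (B + A) ^ 2 := by gcongr; linarith
      _ = _ := by ring
  rw [taylor, abs_div, abs_of_pos (by positivity : 0 < 2 * A)]
  gcongr
  calc _ ≤ |B ^ 2 - A ^ 2 - t| + |(B - A) ^ 2| := abs_sub _ _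
    _ ≤ _ := by rw [abs_of_nonneg (sq_nonneg (B - A))]; gcongr

theorem HasUniformDerivAt.sqrt (hf : HasUniformDerivAt f g θ₀) {c C : ℝ} (hc : 0 < c)
    (hfc : ∀ i, c ≤ f θ₀ i) (hgC : ∀ i, |g i| ≤ C) :
    HasUniformDerivAt (fun θ i => √(f θ i)) (fun i => g i / (2 * √(f θ₀ i))) θ₀ := by
  intro ε hε
  have hnear {a b : ℝ} (hb : 0 < b) : ∀ᶠ h in 𝓝 (0 : ℝ), a * |h| ≤ b := by
    have hcont : Continuous fun h : ℝ => a * |h| := by fun_prop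
    exact hcont.tendsto' 0 0 (by simp) |>.eventually (ge_mem_nhds hb)
  filter_upwards [hf (ε * √c) (by positivity), hf.eventually_abs_sub_le hgC,
    hnear (a := C + 1) hc,
    hnear (a := (C + 1) ^ 2 / c) (b := ε * √c) (by positivity)] with h hlin hlip hh hquad i
  have ha : 0 < f θ₀ i := hc.trans_le (hfc i)
  have hb : 0 ≤ f (θ₀ + h) i := by linarith [(abs_le.1 (hlip i)).1, hfc i]
  have hsq : (f (θ₀ + h) i - f θ₀ i) ^ 2 / f θ₀ i ≤ ε * √c * |h| :=
    calc _ ≤ ((C + 1) * |h|) ^ 2 / c := by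
          rw [← sq_abs]; gcongr; exacts [hlip i, hfc i]
      _ = (C + 1) ^ 2 / c * |h| * |h| := by ring
      _ ≤ _ := by gcongr
  calc _ = |√(f (θ₀ + h) i) - √(f θ₀ i) - h * g i / (2 * √(f θ₀ i))| := by rw [mul_div_assoc]
    _ ≤ _ := abs_sqrt_sub_sqrt_sub_le ha hb _
    _ ≤ (ε * √c * |h| + ε * √c * |h|) / (2 * √c) := by gcongr; exacts [hlin i, hfc i]
    _ = ε * |h| := by field_simp; norm_num

end UniformDeriv

section Expectations

variable {Y : Type} [MeasurableSpace Y] {ν : Measure Y} [SigmaFinite ν] {P : ℝ → Measure Y}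
  {θ₀ : ℝ} {s : Y → ℝ}

theorem IsDQMScore.abs_integral_sub_le (hs : IsDQMScore ν P θ₀ s) (hP : IsDominatedNear ν P θ₀)
    {h : ℝ} [IsFiniteMeasure (P (θ₀ + h))] (hdom : P (θ₀ + h) ≪ ν) {u : Y → ℝ}
    (hu : AEStronglyMeasurable u ν) {C : ℝ} (hC : ∀ᵐ y ∂ν, |u y| ≤ C) :
    |∫ y, u y ∂P (θ₀ + h) - ∫ y, u y ∂P θ₀ - h * ∫ y, s y * u y ∂P θ₀|
      ≤ C * ∫ y, |modelDensity ν (P (θ₀ + h)) y - modelDensity ν (P θ₀) y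
        - h * (s y * modelDensity ν (P θ₀) y)| ∂ν := by
  obtain ⟨hprob, hdom₀⟩ := hP.self_of_nhds
  have hsp := (integrable_mul_modelDensity_iff hdom₀).2 (hs.integrable hP)
  have hp := integrable_modelDensity ν (P θ₀)
  have hp' := integrable_modelDensity ν (P (θ₀ + h))
  have hsup : Integrable (fun y => s y * u y * modelDensity ν (P θ₀) y) ν :=
    (hsp.bdd_mul hu hC).congr (.of_forall fun y => by ring)
  have hdiff : Integrable (fun y => u y * modelDensity ν (P (θ₀ + h)) y
    - u y * modelDensity ν (P θ₀) y) ν := (hp'.bdd_mul hu hC).sub (hp.bdd_mul hu hC)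
  rw [← integral_mul_modelDensity hdom, ← integral_mul_modelDensity hdom₀,
    ← integral_mul_modelDensity hdom₀, ← integral_const_mul, ← integral_const_mul,
    ← integral_sub (hp'.bdd_mul hu hC) (hp.bdd_mul hu hC), ← integral_sub hdiff (hsup.const_mul h)]
  refine abs_integral_le_integral_abs.trans (integral_mono_of_nonneg
    (.of_forall fun y => abs_nonneg _)
    (((hp'.sub hp).sub (hsp.const_mul h)).abs.const_mul C) ?_)
  filter_upwards [hC] with y hy
  calc _ = |u y| * |modelDensity ν (P (θ₀ + h)) y - modelDensity ν (P θ₀) y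
        - h * (s y * modelDensity ν (P θ₀) y)| := by rw [← abs_mul]; ring_nf
    _ ≤ _ := by gcongr

theorem IsDQMScore.hasUniformDerivAt_integral (hs : IsDQMScore ν P θ₀ s)
    (hP : IsDominatedNear ν P θ₀) {ι : Type*} {u : ι → Y → ℝ}
    (hu : ∀ i, AEStronglyMeasurable (u i) ν) {C : ℝ} (hC : ∀ i, ∀ᵐ y ∂ν, |u i y| ≤ C) :
    HasUniformDerivAt (fun θ i => ∫ y, u i y ∂P θ) (fun i => ∫ y, s y * u i y ∂P θ₀) θ₀ := by
  intro ε hε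
  filter_upwards [hs.eventually_integral_abs_modelDensity_sub_le hP
    (ε := ε / (|C| + 1)) (by positivity), eventually_nhds_add hP] with h hh ⟨_, hdom⟩ i
  calc _ ≤ C * _ := hs.abs_integral_sub_le hP hdom (hu i) (hC i)
    _ ≤ (|C| + 1) * (ε / (|C| + 1) * |h|) := by
        gcongr
        linarith [le_abs_self C]
    _ = ε * |h| := by field_simp

theorem IsDQMScore.hasDerivAt_integral (hs : IsDQMScore ν P θ₀ s) (hP : IsDominatedNear ν P θ₀)
    {u : Y → ℝ} (hu : AEStronglyMeasurable u ν) {C : ℝ} (hC : ∀ᵐ y ∂ν, |u y| ≤ C) :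
    HasDerivAt (fun θ => ∫ y, u y ∂P θ) (∫ y, s y * u y ∂P θ₀) θ₀ :=
  (hs.hasUniformDerivAt_integral hP (u := fun _ : Unit => u) (fun _ => hu)
    fun _ => hC).hasDerivAt ()

theorem IsDQMScore.integral_eq_zero (hs : IsDQMScore ν P θ₀ s) (hP : IsDominatedNear ν P θ₀) :
    ∫ y, s y ∂P θ₀ = 0 := by
  have hderiv := hs.hasDerivAt_integral hP (u := fun _ => 1) aestronglyMeasurable_const (C := 1)
    (by simp)
  have hconst : HasDerivAt (fun θ => ∫ _, (1 : ℝ) ∂P θ) 0 θ₀ := by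
    refine (hasDerivAt_const θ₀ (1 : ℝ)).congr_of_eventuallyEq ?_
    filter_upwards [hP] with θ ⟨_, _⟩
    simp
  simpa using hderiv.unique hconst

end Expectations

/-! ### The information of a public outcome -/

section OutcomeInfo

variable {Y : Type} [MeasurableSpace Y] {P₀ : Measure Y} {s : Y → ℝ}

/-- The contribution `(∫ s u dP₀)² / ∫ u dP₀` to the Fisher information of a public outcome that
has conditional probability `u y` given the private value `y`, where `y` has law `P₀` and
score `s`. -/
noncomputable def outcomeInfo (P₀ : Measure Y) (s u : Y → ℝ) : ℝ :=
  (∫ y, s y * u y ∂P₀) ^ 2 / ∫ y, u y ∂P₀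

theorem outcomeInfo_congr_ae {u v : Y → ℝ} (h : u =ᵐ[P₀] v) :
    outcomeInfo P₀ s u = outcomeInfo P₀ s v := by
  have hs : (fun y => s y * u y) =ᵐ[P₀] fun y => s y * v y := (ae_eq_refl s).mul h
  rw [outcomeInfo, outcomeInfo, integral_congr_ae h, integral_congr_ae hs]

theorem outcomeInfo_const_mul (c : ℝ) (u : Y → ℝ) :
    outcomeInfo P₀ s (fun y => c * u y) = c * outcomeInfo P₀ s u := by
  simp only [outcomeInfo, mul_left_comm _ c, integral_const_mul, mul_pow, sq c]
  rcases eq_or_ne c 0 with rfl | hc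
  · simp only [zero_mul, zero_div]
  · rw [mul_assoc, mul_div_mul_left _ _ hc, mul_div_assoc]

theorem two_mul_sub_sq_mul_le_sq_div (v a : ℝ) {b : ℝ} (hb : 0 < b) :
    2 * v * a - v ^ 2 * b ≤ a ^ 2 / b := by
  rw [le_div_iff₀ hb]
  linarith [sq_nonneg (a - v * b)]

theorem sq_sum_div_sum_le {ι : Type*} (t : Finset ι) {w a b : ι → ℝ} (hw : ∀ i ∈ t, 0 ≤ w i)
    (hb : ∀ i ∈ t, 0 < b i) :
    (∑ i ∈ t, w i * a i) ^ 2 / ∑ i ∈ t, w i * b i ≤ ∑ i ∈ t, w i * (a i ^ 2 / b i) := by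
  set A := ∑ i ∈ t, w i * a i with hA
  set B := ∑ i ∈ t, w i * b i with hB
  rcases eq_or_ne B 0 with h0 | h0
  · rw [h0, div_zero]
    exact Finset.sum_nonneg fun i hi => mul_nonneg (hw i hi) (div_nonneg (sq_nonneg _) (hb i hi).le)
  calc A ^ 2 / B = 2 * (A / B) * A - (A / B) ^ 2 * B := by field_simp; ring
    _ = ∑ i ∈ t, w i * (2 * (A / B) * a i - (A / B) ^ 2 * b i) := by
        simp only [mul_sub, mul_left_comm (w _), Finset.sum_sub_distrib, ← Finset.mul_sum, ← hA,
          ← hB]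
    _ ≤ _ := Finset.sum_le_sum fun i hi =>
        mul_le_mul_of_nonneg_left (two_mul_sub_sq_mul_le_sq_div _ _ (hb i hi)) (hw i hi)

theorem outcomeInfo_sum_le {ι : Type*} (t : Finset ι) {w : ι → ℝ} {u : ι → Y → ℝ}
    (hw : ∀ i ∈ t, 0 ≤ w i) (hu : ∀ i ∈ t, Integrable (u i) P₀)
    (hsu : ∀ i ∈ t, Integrable (fun y => s y * u i y) P₀) (hpos : ∀ i ∈ t, 0 < ∫ y, u i y ∂P₀) :
    outcomeInfo P₀ s (fun y => ∑ i ∈ t, w i * u i y) ≤ ∑ i ∈ t, w i * outcomeInfo P₀ s (u i) := by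
  have hA : ∫ y, s y * ∑ i ∈ t, w i * u i y ∂P₀ = ∑ i ∈ t, w i * ∫ y, s y * u i y ∂P₀ := by
    simp only [Finset.mul_sum, mul_left_comm (s _)]
    rw [integral_finsetSum _ fun i hi => (hsu i hi).const_mul _]
    simp only [integral_const_mul]
  have hB : ∫ y, ∑ i ∈ t, w i * u i y ∂P₀ = ∑ i ∈ t, w i * ∫ y, u i y ∂P₀ := by
    rw [integral_finsetSum _ fun i hi => (hu i hi).const_mul _]
    simp only [integral_const_mul]
  rw [outcomeInfo, hA, hB]
  exact sq_sum_div_sum_le t hw hpos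

theorem tendsto_outcomeInfo [IsFiniteMeasure P₀] (hs : Integrable s P₀) {u : ℕ → Y → ℝ}
    {v : Y → ℝ} (hu : ∀ n, AEStronglyMeasurable (u n) P₀) {C : ℝ}
    (hC : ∀ n, ∀ᵐ y ∂P₀, |u n y| ≤ C) (hlim : ∀ᵐ y ∂P₀, Tendsto (u · y) atTop (𝓝 (v y)))
    (hv : ∫ y, v y ∂P₀ ≠ 0) :
    Tendsto (fun n => outcomeInfo P₀ s (u n)) atTop (𝓝 (outcomeInfo P₀ s v)) := by
  refine Tendsto.div (Tendsto.pow ?_ 2) ?_ hv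
  · refine tendsto_integral_of_dominated_convergence (fun y => |s y| * C)
      (fun n => hs.aestronglyMeasurable.mul (hu n)) (hs.abs.mul_const C) (fun n => ?_) ?_
    · filter_upwards [hC n] with y hy
      rw [norm_mul]
      exact mul_le_mul_of_nonneg_left hy (norm_nonneg _)
    · filter_upwards [hlim] with y hy using hy.const_mul (s y)
  · exact tendsto_integral_of_dominated_convergence (fun _ => C) hu (integrable_const C) hC hlim

end OutcomeInfo

/-! ### Fisher information of uniformly differentiable models -/

section FisherInfo

variable {Z : Type} [MeasurableSpace Z] {ν : Measure Z} [IsFiniteMeasure ν] {R : ℝ → Measure Z}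
  {f : ℝ → Z → ℝ} {g : Z → ℝ} {θ₀ c C : ℝ}

theorem exists_pos_ofReal_sq_mul_measure_univ_le (ν : Measure Z) [IsFiniteMeasure ν] {ε : ENNReal}
    (hε : 0 < ε) : ∃ η : ℝ, 0 < η ∧ ENNReal.ofReal (η ^ 2) * ν Set.univ ≤ ε := by
  have hlim : Tendsto (fun η : ℝ => ENNReal.ofReal (η ^ 2) * ν Set.univ) (𝓝[>] 0) (𝓝 0) := by
    have hcont : Continuous fun η : ℝ => ENNReal.ofReal (η ^ 2) * ν Set.univ :=
      ENNReal.continuous_mul_const (measure_ne_top ν _) |>.comp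
        (ENNReal.continuous_ofReal.comp (continuous_pow 2))
    exact (hcont.tendsto' 0 0 (by simp)).mono_left nhdsWithin_le_nhds
  exact (eventually_mem_nhdsWithin.and (hlim.eventually (ge_mem_nhds hε))).exists

theorem HasUniformDerivAt.isDQMScore (hf : HasUniformDerivAt f g θ₀) (hc : 0 < c)
    (hfc : ∀ z, c ≤ f θ₀ z) (hgC : ∀ z, |g z| ≤ C) (hfm : Measurable (f θ₀)) (hg : Measurable g)
    (hR : ∀ᶠ θ in 𝓝 θ₀, modelDensity ν (R θ) =ᵐ[ν] f θ) :
    IsDQMScore ν R θ₀ (fun z => g z / f θ₀ z) := by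
  refine ⟨hg.div hfm, ENNReal.tendsto_nhds_zero.2 fun ε hε => ?_⟩
  obtain ⟨η, hη, hηε⟩ := exists_pos_ofReal_sq_mul_measure_univ_le ν hε
  filter_upwards [eventually_nhdsWithin_of_eventually_nhds (hf.sqrt hc hfc hgC η hη),
    eventually_nhdsWithin_of_eventually_nhds (eventually_nhds_add hR)] with h hunif hRh
  refine ENNReal.div_le_of_le_mul ?_
  calc _ ≤ ∫⁻ _, ENNReal.ofReal (η ^ 2 * h ^ 2) ∂ν := by
        refine lintegral_mono_ae ?_
        filter_upwards [hRh, hR.self_of_nhds] with z hz hz₀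
        have hsqrt : 1 / 2 * h * (g z / f θ₀ z) * √(f θ₀ z) = h * (g z / (2 * √(f θ₀ z))) := by
          have hpos : 0 < √(f θ₀ z) := Real.sqrt_pos.2 (hc.trans_le (hfc z))
          nth_rw 1 [← Real.sq_sqrt (hc.le.trans (hfc z))]
          field_simp
        rw [hz, hz₀, hsqrt, ← mul_pow, ← sq_abs, ← sq_abs (η * h), abs_mul, abs_of_pos hη]
        gcongr
        exact hunif z
    _ = ENNReal.ofReal (η ^ 2) * ν Set.univ * ENNReal.ofReal (h ^ 2) := by
        rw [lintegral_const, ENNReal.ofReal_mul (sq_nonneg η), mul_right_comm]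
    _ ≤ _ := by gcongr

theorem HasUniformDerivAt.hasFisherInfo_of_eq_withDensity {Θ : Set ℝ} (hθ₀ : θ₀ ∈ interior Θ)
    (hf : HasUniformDerivAt f g θ₀) (hc : 0 < c) (hfc : ∀ θ ∈ Θ, ∀ z, c ≤ f θ z)
    (hgC : ∀ z, |g z| ≤ C) (hfm : ∀ θ ∈ Θ, Measurable (f θ)) (hg : Measurable g)
    (hR : ∀ θ ∈ Θ, R θ = ν.withDensity fun z => ENNReal.ofReal (f θ z)) :
    HasFisherInfo Θ R θ₀ (∫ z, g z ^ 2 / f θ₀ z ∂ν) := by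
  have hmem : θ₀ ∈ Θ := interior_subset hθ₀
  refine ⟨ν, inferInstance, fun θ hθ => hR θ hθ ▸ withDensity_absolutelyContinuous _ _,
    fun z => g z / f θ₀ z, hf.isDQMScore hc (hfc θ₀ hmem) hgC (hfm θ₀ hmem) hg ?_, ?_⟩
  · filter_upwards [mem_interior_iff_mem_nhds.1 hθ₀] with θ hθ
    rw [hR θ hθ]
    exact modelDensity_withDensity_ofReal ν (hfm θ hθ).aemeasurable
      (.of_forall fun z => hc.le.trans (hfc θ hθ z))
  · rw [hR θ₀ hmem, integral_withDensity_eq_integral_toReal_smul (hfm θ₀ hmem).ennreal_ofReal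
      (.of_forall fun _ => ENNReal.ofReal_lt_top)]
    refine integral_congr_ae (.of_forall fun z => ?_)
    have hpos : 0 < f θ₀ z := hc.trans_le (hfc θ₀ hmem z)
    simp only [smul_eq_mul, ENNReal.toReal_ofReal hpos.le]
    field_simp

variable {Y : Type} [MeasurableSpace Y] {lam : Measure Y} [SigmaFinite lam] {P : ℝ → Measure Y}
  {s : Y → ℝ}

theorem abs_integral_mul_le {P₀ : Measure Y} (hs : Integrable s P₀) {u : Y → ℝ}
    (hC : ∀ᵐ y ∂P₀, |u y| ≤ C) : |∫ y, s y * u y ∂P₀| ≤ C * ∫ y, |s y| ∂P₀ := by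
  rw [← integral_const_mul]
  refine abs_integral_le_integral_abs.trans (integral_mono_of_nonneg
    (.of_forall fun y => abs_nonneg _) (hs.abs.const_mul C) ?_)
  filter_upwards [hC] with y hy
  rw [abs_mul, mul_comm]
  exact mul_le_mul_of_nonneg_right hy (abs_nonneg _)

/-- The densities `∫ u z dP_θ` are those of the model privatized by the mechanism that reports `z`
with conditional density `u z`. -/
theorem IsDQMScore.hasFisherInfo_of_eq_withDensity {Θ : Set ℝ} (hs : IsDQMScore lam P θ₀ s)
    (hθ₀ : θ₀ ∈ interior Θ) (hP : ∀ θ ∈ Θ, IsProbabilityMeasure (P θ))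
    (hdom : ∀ θ ∈ Θ, P θ ≪ lam) {u : Z → Y → ℝ} (hu : ∀ z, AEStronglyMeasurable (u z) lam)
    (hc : 0 < c) (hcC : ∀ z, ∀ᵐ y ∂lam, c ≤ u z y ∧ u z y ≤ C)
    (hfm : ∀ θ ∈ Θ, Measurable fun z => ∫ y, u z y ∂P θ)
    (hgm : Measurable fun z => ∫ y, s y * u z y ∂P θ₀)
    (hR : ∀ θ ∈ Θ, R θ = ν.withDensity fun z => ENNReal.ofReal (∫ y, u z y ∂P θ)) :
    HasFisherInfo Θ R θ₀ (∫ z, outcomeInfo (P θ₀) s (u z) ∂ν) := by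
  have hmem : θ₀ ∈ Θ := interior_subset hθ₀
  have hnear := isDominatedNear_of_mem_interior hθ₀ hP hdom
  have habs (z : Z) : ∀ᵐ y ∂lam, |u z y| ≤ C := by
    filter_upwards [hcC z] with y hy
    exact abs_le.2 ⟨by linarith [hy.1, hy.2], hy.2⟩
  refine (hs.hasUniformDerivAt_integral hnear hu habs).hasFisherInfo_of_eq_withDensity hθ₀ hc
    (fun θ hθ z => ?_)
    (fun z => abs_integral_mul_le (hs.integrable hnear) ((hdom θ₀ hmem).ae_le (habs z))) hfm hgm
    hR
  have := hP θ hθ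
  have hint : Integrable (u z) (P θ) :=
    .of_bound ((hu z).mono_ac (hdom θ hθ)) C ((hdom θ hθ).ae_le (habs z))
  calc c = ∫ _, c ∂P θ := by simp
    _ ≤ _ := integral_mono_ae (integrable_const c) hint
        ((hdom θ hθ).ae_le ((hcC z).mono fun y hy => hy.1))

end FisherInfo

/-! ### The set `B` and the information functional -/

section StairBox

variable {𝒳 : Type} [MeasurableSpace 𝒳] {lam : Measure 𝒳} {α : ℝ}

instance StairBox.instBorelSpace : BorelSpace (StairBox lam α) := ⟨rfl⟩

theorem StairBox.measurable_toFun (r : StairBox lam α) : Measurable (r.toFun : 𝒳 → ℝ) :=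
  r.toFun.stronglyMeasurable.measurable

theorem StairBox.ae_abs_le (r : StairBox lam α) : ∀ᵐ x ∂lam, |r.toFun x| ≤ Real.exp α := by
  filter_upwards [r.bounds] with x hx
  exact abs_le.2 ⟨by linarith, hx.2⟩

theorem StairBox.exists_representative (hα : 0 ≤ α) (r : StairBox lam α) :
    ∃ u : 𝒳 → ℝ, Measurable u ∧ (∀ x, 1 ≤ u x ∧ u x ≤ Real.exp α) ∧ r.toFun =ᵐ[lam] u := by
  refine ⟨fun x => max 1 (min (r.toFun x) (Real.exp α)),
    measurable_const.max (r.measurable_toFun.min measurable_const),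
    fun x => ⟨le_max_left _ _, max_le (Real.one_le_exp hα) (min_le_right _ _)⟩, ?_⟩
  filter_upwards [r.bounds] with x hx
  rw [min_eq_left hx.2, max_eq_right hx.1]

theorem exists_mem_stairExtremal_ae_eq (hα : 0 ≤ α) {u : 𝒳 → ℝ} (hu : AEStronglyMeasurable u lam)
    (h : ∀ᵐ x ∂lam, u x = 1 ∨ u x = Real.exp α) :
    ∃ r ∈ stairExtremal lam α, r.toFun =ᵐ[lam] u := by
  have hmk := AEEqFun.coeFn_mk u hu
  refine ⟨⟨AEEqFun.mk u hu, ?_⟩, ?_, hmk⟩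
  · filter_upwards [hmk, h] with x hx hux
    have := Real.one_le_exp hα
    rw [hx]
    rcases hux with hux | hux <;> rw [hux]
    exacts [⟨le_rfl, this⟩, ⟨this, le_rfl⟩]
  · change ∀ᵐ x ∂lam, _ ∨ _
    filter_upwards [hmk, h] with x hx hux
    rwa [hx]

theorem toFun_stairSwap_ae (r : StairBox lam α) :
    ∀ᵐ x ∂lam, (stairSwap r).toFun x = Real.exp α + 1 - r.toFun x :=
  stairSwap_coeFn α r.toFun

variable {P₀ : Measure 𝒳}

theorem StairBox.integrable_mul (hP : P₀ ≪ lam) (r : StairBox lam α) {f : 𝒳 → ℝ}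
    (hf : Integrable f P₀) : Integrable (fun x => f x * r.toFun x) P₀ :=
  hf.mul_bdd r.measurable_toFun.aestronglyMeasurable (hP.ae_le r.ae_abs_le)

theorem integral_mul_stairSwap (hP : P₀ ≪ lam) (r : StairBox lam α) {f : 𝒳 → ℝ}
    (hf : Integrable f P₀) :
    ∫ x, f x * (stairSwap r).toFun x ∂P₀
      = (Real.exp α + 1) * ∫ x, f x ∂P₀ - ∫ x, f x * r.toFun x ∂P₀ := by
  rw [← integral_const_mul, ← integral_sub (hf.const_mul _) (r.integrable_mul hP hf)]
  refine integral_congr_ae ?_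
  filter_upwards [hP.ae_le (toFun_stairSwap_ae r)] with x hx
  rw [hx]; ring

theorem integral_stairSwap [IsProbabilityMeasure P₀] (hP : P₀ ≪ lam) (r : StairBox lam α) :
    ∫ x, (stairSwap r).toFun x ∂P₀ = Real.exp α + 1 - ∫ x, r.toFun x ∂P₀ := by
  simpa using integral_mul_stairSwap hP r (integrable_const 1)

theorem StairBox.one_le_integral_and_le [IsProbabilityMeasure P₀] (hP : P₀ ≪ lam)
    (r : StairBox lam α) : 1 ≤ ∫ x, r.toFun x ∂P₀ ∧ ∫ x, r.toFun x ∂P₀ ≤ Real.exp α := by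
  have hbounds : ∀ᵐ x ∂P₀, 1 ≤ r.toFun x ∧ r.toFun x ≤ Real.exp α := hP.ae_le r.bounds
  have hint : Integrable r.toFun P₀ := by simpa using r.integrable_mul hP (integrable_const 1)
  constructor
  · simpa using integral_mono_ae (integrable_const 1) hint (hbounds.mono fun x hx => hx.1)
  · simpa using integral_mono_ae hint (integrable_const _) (hbounds.mono fun x hx => hx.2)

theorem StairBox.integral_pos [IsProbabilityMeasure P₀] (hP : P₀ ≪ lam) (r : StairBox lam α) :
    0 < ∫ x, r.toFun x ∂P₀ :=
  zero_lt_one.trans_le (r.one_le_integral_and_le hP).1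

variable [SigmaFinite lam]

theorem StairBox.continuous_integral_mul [SigmaFinite P₀] (hP : P₀ ≪ lam) {f : 𝒳 → ℝ}
    (hf : Integrable f P₀) :
    Continuous fun r : StairBox lam α => ∫ x, f x * r.toFun x ∂P₀ := by
  have hfp := (integrable_mul_modelDensity_iff hP).2 hf
  have hcont : Continuous fun r : StairBox lam α => ∫ x, hfp.toL1 _ x * r.toFun x ∂lam :=
    continuous_iInf_dom (i := hfp.toL1 _) continuous_induced_dom
  refine hcont.congr fun r => ?_
  rw [← integral_mul_modelDensity hP]
  refine integral_congr_ae ?_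
  filter_upwards [hfp.coeFn_toL1] with x hx
  rw [hx, mul_right_comm]

theorem StairBox.continuous_integral [IsFiniteMeasure P₀] (hP : P₀ ≪ lam) :
    Continuous fun r : StairBox lam α => ∫ x, r.toFun x ∂P₀ := by
  simpa only [one_mul] using StairBox.continuous_integral_mul hP (integrable_const 1)

theorem continuous_stairSwap : Continuous (stairSwap : StairBox lam α → StairBox lam α) := by
  refine continuous_iInf_rng.2 fun f => continuous_induced_rng.2 ?_
  have hf : Integrable f lam := L1.integrable_coeFn f
  have hcont : Continuous fun r : StairBox lam α =>
      (Real.exp α + 1) * ∫ x, f x ∂lam - ∫ x, f x * r.toFun x ∂lam :=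
    continuous_const.sub (StairBox.continuous_integral_mul .rfl hf)
  exact hcont.congr fun r => (integral_mul_stairSwap .rfl r hf).symm

theorem measurable_stairSwapE :
    Measurable (stairSwapE : stairExtremal lam α → stairExtremal lam α) :=
  (continuous_stairSwap.measurable.comp measurable_subtype_coe).subtype_mk

end StairBox

section StairInfo

variable {𝒳 : Type} [MeasurableSpace 𝒳] {lam : Measure 𝒳} [SigmaFinite lam] {α : ℝ}
  {P₀ : Measure 𝒳} [IsProbabilityMeasure P₀] {s : 𝒳 → ℝ}

theorem stairInfo_eq_outcomeInfo (hP : P₀ ≪ lam) (s : 𝒳 → ℝ) (r : StairBox lam α) :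
    stairInfo s (modelDensity lam P₀) r = outcomeInfo P₀ s r.toFun := by
  rw [stairInfo, outcomeInfo, integral_mul_modelDensity hP, integral_mul_modelDensity hP]

theorem continuous_stairInfo (hP : P₀ ≪ lam) (hs : Integrable s P₀) :
    Continuous fun r : StairBox lam α => stairInfo s (modelDensity lam P₀) r := by
  simp only [stairInfo_eq_outcomeInfo hP]
  exact ((StairBox.continuous_integral_mul hP hs).pow 2).div (StairBox.continuous_integral hP)
    fun r => (r.integral_pos hP).ne'

theorem stairInfo_nonneg (hP : P₀ ≪ lam) (s : 𝒳 → ℝ) (r : StairBox lam α) :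
    0 ≤ stairInfo s (modelDensity lam P₀) r := by
  rw [stairInfo_eq_outcomeInfo hP]
  exact div_nonneg (sq_nonneg _) (r.integral_pos hP).le

theorem stairInfo_le (hP : P₀ ≪ lam) (hs : Integrable s P₀) (r : StairBox lam α) :
    stairInfo s (modelDensity lam P₀) r ≤ (Real.exp α * ∫ x, |s x| ∂P₀) ^ 2 := by
  rw [stairInfo_eq_outcomeInfo hP]
  calc _ ≤ (∫ x, s x * r.toFun x ∂P₀) ^ 2 :=
        div_le_self (sq_nonneg _) (r.one_le_integral_and_le hP).1
    _ = |∫ x, s x * r.toFun x ∂P₀| ^ 2 := (sq_abs _).symm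
    _ ≤ _ := by gcongr; exact abs_integral_mul_le hs (hP.ae_le r.ae_abs_le)

theorem integrable_stairInfo (hP : P₀ ≪ lam) (hs : Integrable s P₀)
    (μ : Measure (stairExtremal lam α)) [IsFiniteMeasure μ] :
    Integrable (fun r => stairInfo s (modelDensity lam P₀) r.1) μ := by
  refine .of_bound ((continuous_stairInfo hP hs).measurable.comp
    measurable_subtype_coe).aestronglyMeasurable ((Real.exp α * ∫ x, |s x| ∂P₀) ^ 2)
    (.of_forall fun r => ?_)
  rw [Real.norm_of_nonneg (stairInfo_nonneg hP s r.1)]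
  exact stairInfo_le hP hs r.1

end StairInfo

/-! ### The evaluation operator -/

theorem tendsto_one_div_add_one_nhdsGT :
    Tendsto (fun n : ℕ => 1 / ((n : ℝ) + 1)) atTop (𝓝[>] 0) :=
  tendsto_nhdsWithin_iff.2 ⟨tendsto_one_div_add_atTop_nhds_zero_nat,
    .of_forall fun n => Set.mem_Ioi.2 n.one_div_pos_of_nat⟩

section Evaluation

variable {𝒳 : Type} [MeasurableSpace 𝒳]

theorem setAverage_eq_integral_cond (lam : Measure 𝒳) (A : Set 𝒳) (f : 𝒳 → ℝ) :
    ⨍ y in A, f y ∂lam = ∫ y, f y ∂lam[|A] := by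
  rw [average, Measure.restrict_apply_univ, ProbabilityTheory.cond]

variable [PseudoMetricSpace 𝒳]

/-- The measures for which closed balls have positive finite mass and bounded measurable functions
are a.e. the limits of their averages over shrinking balls. -/
class IsBallDifferentiating (lam : Measure 𝒳) : Prop where
  closedBall_pos : ∀ (x : 𝒳) {δ : ℝ}, 0 < δ → 0 < lam (Metric.closedBall x δ)
  closedBall_lt_top : ∀ (x : 𝒳) (δ : ℝ), lam (Metric.closedBall x δ) < ⊤
  ae_tendsto_average : ∀ f : 𝒳 → ℝ, MemLp f ⊤ lam →
    ∀ᵐ x ∂lam, Tendsto (fun δ => ⨍ y in Metric.closedBall x δ, f y ∂lam) (𝓝[>] 0) (𝓝 (f x))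

variable {lam : Measure 𝒳} {α : ℝ}

theorem IsStairNormalized.isFiniteMeasure {μ : Measure (stairExtremal lam α)}
    (hμ : IsStairNormalized μ) : IsFiniteMeasure μ :=
  ⟨hμ.subprob.trans_lt ENNReal.one_lt_top⟩

variable [IsBallDifferentiating lam]

theorem IsBallDifferentiating.ae_neBot [Nonempty 𝒳] : (ae lam).NeBot := by
  rw [MeasureTheory.ae_neBot]
  rintro rfl
  simpa using closedBall_pos (lam := (0 : Measure 𝒳)) (Classical.arbitrary 𝒳) one_pos

theorem IsBallDifferentiating.isProbabilityMeasure_cond (x : 𝒳) {δ : ℝ} (hδ : 0 < δ) :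
    IsProbabilityMeasure (lam[|Metric.closedBall x δ]) :=
  cond_isProbabilityMeasure_of_finite (closedBall_pos x hδ).ne' (closedBall_lt_top x δ).ne

theorem stairEval_ae (r : StairBox lam α) : ∀ᵐ x ∂lam, stairEval x r = r.toFun x := by
  have hr : MemLp r.toFun ⊤ lam :=
    memLp_top_of_bound r.measurable_toFun.aestronglyMeasurable (Real.exp α) r.ae_abs_le
  filter_upwards [IsBallDifferentiating.ae_tendsto_average _ hr] with x hx
  exact (hx.comp tendsto_one_div_add_one_nhdsGT).limsup_eq

theorem IsBallDifferentiating.sigmaFinite : SigmaFinite lam := by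
  rcases isEmpty_or_nonempty 𝒳 with h | ⟨⟨x⟩⟩
  · infer_instance
  exact ⟨⟨⟨fun n : ℕ => Metric.closedBall x n, fun _ => trivial, fun n => closedBall_lt_top x n,
    Metric.iUnion_closedBall_nat x⟩⟩⟩

theorem measurable_stairEval (x : 𝒳) : Measurable fun r : StairBox lam α => stairEval x r := by
  have := IsBallDifferentiating.sigmaFinite (lam := lam)
  refine Measurable.limsup fun n => ?_
  have := IsBallDifferentiating.isProbabilityMeasure_cond (lam := lam) x n.one_div_pos_of_nat
  simp only [setAverage_eq_integral_cond]
  exact (StairBox.continuous_integral cond_absolutelyContinuous).measurable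

theorem exp_add_one_le_stairEval_add_stairEval_stairSwap (x : 𝒳) (r : StairBox lam α) :
    Real.exp α + 1 ≤ stairEval x r + stairEval x (stairSwap r) := by
  set u : ℕ → ℝ := fun n => ⨍ y in Metric.closedBall x (1 / ((n : ℝ) + 1)), r.toFun y ∂lam with hu
  have hprob (n : ℕ) := IsBallDifferentiating.isProbabilityMeasure_cond (lam := lam) x
    n.one_div_pos_of_nat
  have hswap (n : ℕ) : ⨍ y in Metric.closedBall x (1 / ((n : ℝ) + 1)), (stairSwap r).toFun y ∂lam
      = Real.exp α + 1 - u n := by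
    have := hprob n
    simp only [hu, setAverage_eq_integral_cond]
    exact integral_stairSwap cond_absolutelyContinuous r
  have hmem (n : ℕ) : 1 ≤ u n ∧ u n ≤ Real.exp α := by
    have := hprob n
    simp only [hu, setAverage_eq_integral_cond]
    exact r.one_le_integral_and_le cond_absolutelyContinuous
  have habove : IsBoundedUnder (· ≤ ·) atTop u := isBoundedUnder_of ⟨_, fun n => (hmem n).2⟩
  have hbelow : IsBoundedUnder (· ≥ ·) atTop u := isBoundedUnder_of ⟨_, fun n => (hmem n).1⟩
  have hliminf : stairEval x (stairSwap r) = Real.exp α + 1 - liminf u atTop := by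
    simp only [stairEval, hswap]
    exact limsup_const_sub atTop u _ habove.isCoboundedUnder_ge hbelow
  rw [hliminf]
  linarith [show liminf u atTop ≤ stairEval x r from liminf_le_limsup habove hbelow]

theorem IsStairNormalized.mass_le [Nonempty 𝒳] {μ : Measure (stairExtremal lam α)}
    (hμ : IsStairNormalized μ) (hsymm : μ.map stairSwapE = μ) :
    μ.real Set.univ ≤ 2 / (Real.exp α + 1) := by
  have := hμ.isFiniteMeasure
  have := IsBallDifferentiating.sigmaFinite (lam := lam)
  have := IsBallDifferentiating.ae_neBot (lam := lam)
  obtain ⟨x, hx⟩ := hμ.normalized.exists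
  set e : stairExtremal lam α → ℝ := fun r => stairEval x r.1
  have hmeas : Measurable e := (measurable_stairEval x).comp measurable_subtype_coe
  have hint : Integrable e μ := .of_integral_ne_zero (by rw [hx]; exact one_ne_zero)
  have hpres : MeasurePreserving stairSwapE μ μ := ⟨measurable_stairSwapE, hsymm⟩
  have hswap : ∫ r, e (stairSwapE r) ∂μ = 1 := by
    rw [← integral_map measurable_stairSwapE.aemeasurable hmeas.aestronglyMeasurable, hsymm]
    exact hx
  rw [le_div_iff₀ (by positivity)]
  calc μ.real Set.univ * (Real.exp α + 1)
      = ∫ _, Real.exp α + 1 ∂μ := by rw [integral_const, smul_eq_mul]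
    _ ≤ ∫ r, (e r + e (stairSwapE r)) ∂μ :=
      integral_mono (integrable_const _)
        (hint.add (hpres.integrable_comp_of_integrable hint))
        fun r => exp_add_one_le_stairEval_add_stairEval_stairSwap x r.1
    _ = 2 := by
      refine (integral_add hint (hpres.integrable_comp_of_integrable hint)).trans ?_
      rw [Function.comp_def, hswap, hx]
      norm_num

end Evaluation

section Lebesgue

variable {d : ℕ} {X : Set (EuclideanSpace ℝ (Fin d))}

theorem map_lebesgueOn (hX : MeasurableSet X) :
    (lebesgueOn X).map Subtype.val = volume.restrict X :=
  map_comap_subtype_coe hX _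

theorem lebesgueOn_apply (hX : MeasurableSet X) (A : Set X) :
    lebesgueOn X A = volume (Subtype.val '' A) :=
  comap_subtype_coe_apply hX _ _

theorem setAverage_lebesgueOn (hX : MeasurableSet X) {f : X → ℝ}
    {F : EuclideanSpace ℝ (Fin d) → ℝ} (hF : ∀ x : X, F x = f x) (x : X) {δ : ℝ}
    (hsub : Metric.closedBall (x : EuclideanSpace ℝ (Fin d)) δ ⊆ X) :
    ⨍ y in Metric.closedBall x δ, f y ∂lebesgueOn X
      = ⨍ y in Metric.closedBall (x : EuclideanSpace ℝ (Fin d)) δ, F y := by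
  have hball : Subtype.val ⁻¹' Metric.closedBall (x : EuclideanSpace ℝ (Fin d)) δ
      = Metric.closedBall x δ := rfl
  have hvol : (lebesgueOn X).real (Metric.closedBall x δ)
      = volume.real (Metric.closedBall (x : EuclideanSpace ℝ (Fin d)) δ) := by
    rw [measureReal_def, measureReal_def, lebesgueOn_apply hX, ← hball, Subtype.image_preimage_coe,
      Set.inter_eq_right.2 hsub]
  rw [setAverage_eq, setAverage_eq, hvol, ← Measure.restrict_restrict_of_subset hsub,
    ← map_lebesgueOn hX, (MeasurableEmbedding.subtype_coe hX).setIntegral_map, hball]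
  simp only [hF]

theorem ae_tendsto_average_lebesgueOn (hX : IsOpen X) {f : X → ℝ}
    (hf : MemLp f ⊤ (lebesgueOn X)) :
    ∀ᵐ x ∂lebesgueOn X, Tendsto (fun δ => ⨍ y in Metric.closedBall x δ, f y ∂lebesgueOn X)
      (𝓝[>] 0) (𝓝 (f x)) := by
  have hemb := MeasurableEmbedding.subtype_coe hX.measurableSet
  set F : EuclideanSpace ℝ (Fin d) → ℝ := Function.extend Subtype.val f 0
  have hFX (x : X) : F x = f x := Subtype.val_injective.extend_apply f 0 x
  have hF : MemLp F ⊤ volume := by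
    have hind : X.indicator F = F := by
      refine Set.indicator_eq_self.2 fun y hy => ?_
      by_contra hyX
      exact hy (Function.extend_apply' _ _ _ fun ⟨x, hx⟩ => hyX (hx ▸ x.2))
    rw [← hind, memLp_indicator_iff_restrict hX.measurableSet, ← map_lebesgueOn hX.measurableSet,
      hemb.memLp_map_measure_iff]
    exact (memLp_congr_ae (.of_forall hFX)).2 hf
  have hlim := ae_restrict_of_ae (s := X) (IsUnifLocDoublingMeasure.ae_tendsto_average volume
    (hF.locallyIntegrable le_top) 1)
  rw [← map_lebesgueOn hX.measurableSet, hemb.ae_map_iff] at hlim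
  filter_upwards [hlim] with x hx
  have hsub : ∀ᶠ δ in 𝓝[>] (0 : ℝ), Metric.closedBall (x : EuclideanSpace ℝ (Fin d)) δ ⊆ X :=
    eventually_nhdsWithin_of_eventually_nhds
      (eventually_closedBall_subset (hX.mem_nhds x.2))
  rw [← hFX]
  refine (hx (fun _ => x) id tendsto_id ?_).congr' ?_
  · filter_upwards [self_mem_nhdsWithin] with δ hδ
    exact Metric.mem_closedBall_self (by simpa using (Set.mem_Ioi.1 hδ).le)
  · filter_upwards [hsub] with δ hδ
    exact (setAverage_lebesgueOn hX.measurableSet hFX x hδ).symm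

theorem isBallDifferentiating_lebesgueOn (hX : IsOpen X) :
    IsBallDifferentiating (lebesgueOn X) where
  closedBall_pos x δ hδ := by
    rw [lebesgueOn_apply hX.measurableSet]
    refine ((hX.inter Metric.isOpen_ball).measure_pos volume
      ⟨(x : EuclideanSpace ℝ (Fin d)), x.2, Metric.mem_ball_self hδ⟩).trans_le (measure_mono ?_)
    rintro y ⟨hy, hyδ⟩
    exact ⟨⟨y, hy⟩, (Metric.mem_ball.1 hyδ).le, rfl⟩
  closedBall_lt_top x δ := by
    rw [lebesgueOn_apply hX.measurableSet]
    refine (measure_mono ?_).trans_lt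
      (measure_closedBall_lt_top (x := (x : EuclideanSpace ℝ (Fin d))) (r := δ))
    rintro _ ⟨y, hy, rfl⟩
    exact hy
  ae_tendsto_average f hf := ae_tendsto_average_lebesgueOn hX hf

end Lebesgue

/-! ### Finite mixtures of staircases -/

section DiscreteMeasure

variable {ι Y : Type*} [Fintype ι] [MeasurableSpace Y]

/-- The finitely supported measure with masses `w i` at the points `r i`. -/
noncomputable def discreteMeasure (w : ι → ℝ) (r : ι → Y) : Measure Y :=
  ∑ i, ENNReal.ofReal (w i) • Measure.dirac (r i)

theorem integral_discreteMeasure {w : ι → ℝ} (hw : ∀ i, 0 ≤ w i) (r : ι → Y) {f : Y → ℝ}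
    (hf : Measurable f) : ∫ y, f y ∂(discreteMeasure w r) = ∑ i, w i * f (r i) := by
  rw [discreteMeasure, integral_finsetSum_measure fun i _ =>
    (integrable_dirac' hf.stronglyMeasurable enorm_lt_top).smul_measure ENNReal.ofReal_ne_top]
  refine Finset.sum_congr rfl fun i _ => ?_
  rw [integral_smul_measure, integral_dirac' _ _ hf.stronglyMeasurable,
    ENNReal.toReal_ofReal (hw i), smul_eq_mul]

theorem innerRegular_discreteMeasure [TopologicalSpace Y] (w : ι → ℝ) (r : ι → Y) :
    (discreteMeasure w r).InnerRegular := by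
  refine ⟨fun U hU c hc => ⟨U ∩ Set.range r, Set.inter_subset_left,
    ((Set.finite_range r).subset Set.inter_subset_right).isCompact, hc.trans_le ?_⟩⟩
  simp only [discreteMeasure, Measure.finsetSum_apply, Measure.smul_apply, smul_eq_mul]
  refine Finset.sum_le_sum fun i _ => mul_le_mul_right ?_ _
  rw [Measure.dirac_apply' _ hU]
  refine le_of_eq_of_le ?_ Measure.le_dirac_apply
  by_cases h : r i ∈ U <;> simp [h]

end DiscreteMeasure

theorem exists_two_valued_sum_eq {𝒳 : Type*} [MeasurableSpace 𝒳] (f : SimpleFunc 𝒳 ℝ) {a b : ℝ}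
    (hab : a ≤ b) (hf : ∀ x, f x ∈ Set.Icc a b) :
    ∃ (κ : Type) (_ : Fintype κ) (w : κ → ℝ) (v : κ → SimpleFunc 𝒳 ℝ), (∀ k, 0 ≤ w k) ∧
      ∑ k, w k = 1 ∧ (∀ k x, v k x = a ∨ v k x = b) ∧ ∀ x, f x = ∑ k, w k * v k x := by
  have hmem : (Subtype.val : f.range → ℝ) ∈
      convexHull ℝ (Set.univ.pi fun _ => ({a, b} : Set ℝ)) := by
    rw [convexHull_pi, Set.mem_univ_pi]
    rintro ⟨y, hy⟩
    obtain ⟨x, rfl⟩ := SimpleFunc.mem_range.1 hy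
    rw [convexHull_pair, segment_eq_Icc hab]
    exact hf x
  obtain ⟨κ, _, w, z, hw, hw1, hz, hsum⟩ := mem_convexHull_iff_exists_fintype.1 hmem
  have hmap (k : κ) (x : 𝒳) : f.map (Function.extend Subtype.val (z k) 0) x
      = z k ⟨f x, f.mem_range_self x⟩ :=
    Subtype.val_injective.extend_apply (z k) 0 ⟨f x, f.mem_range_self x⟩
  refine ⟨κ, inferInstance, w, fun k => f.map (Function.extend Subtype.val (z k) 0), hw, hw1,
    fun k x => ?_, fun x => ?_⟩
  · rw [hmap]
    exact hz k _ trivial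
  · simpa only [hmap, Finset.sum_apply, Pi.smul_apply, smul_eq_mul]
      using (congrFun hsum ⟨f x, f.mem_range_self x⟩).symm

theorem exists_simpleFunc_tendsto {𝒳 ι : Type*} [MeasurableSpace 𝒳] [Fintype ι] {c : ι → ℝ}
    {a b m : ℝ} {r : ι → 𝒳 → ℝ} (hr : ∀ j, Measurable (r j)) (hr' : ∀ j x, r j x ∈ Set.Icc a b)
    (hsum : ∀ x, ∑ j, c j * r j x = m) :
    ∃ g : ℕ → ι → SimpleFunc 𝒳 ℝ, (∀ n j x, g n j x ∈ Set.Icc a b) ∧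
      (∀ n x, ∑ j, c j * g n j x = m) ∧ ∀ j x, Tendsto (fun n => g n j x) atTop (𝓝 (r j x)) := by
  rcases isEmpty_or_nonempty 𝒳 with _ | ⟨⟨x₀⟩⟩
  · exact ⟨fun _ _ => 0, fun _ _ => isEmptyElim, fun _ => isEmptyElim, fun _ => isEmptyElim⟩
  let K : Set (ι → ℝ) := {v | (∀ j, v j ∈ Set.Icc a b) ∧ ∑ j, c j * v j = m}
  let F : 𝒳 → ι → ℝ := fun x j => r j x
  have hF : Measurable F := measurable_pi_lambda _ hr
  have hFK (x : 𝒳) : F x ∈ K := ⟨fun j => hr' j x, hsum x⟩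
  let f : ℕ → SimpleFunc 𝒳 (ι → ℝ) := SimpleFunc.approxOn F hF K (F x₀) (hFK x₀)
  have hf (n : ℕ) (x : 𝒳) : f n x ∈ K := SimpleFunc.approxOn_mem hF (hFK x₀) n x
  exact ⟨fun n j => (f n).map fun v : ι → ℝ => v j, fun n j x => (hf n x).1 j,
    fun n x => (hf n x).2, fun j x =>
      tendsto_pi_nhds.1 (SimpleFunc.tendsto_approxOn hF (hFK x₀) (subset_closure (hFK x))) j⟩

theorem integral_pos_of_one_le {Y : Type*} [MeasurableSpace Y] {P₀ : Measure Y}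
    [IsProbabilityMeasure P₀] {u : Y → ℝ} (hu : Integrable u P₀) (h : ∀ y, 1 ≤ u y) :
    0 < ∫ y, u y ∂P₀ :=
  calc (0 : ℝ) < ∫ _, 1 ∂P₀ := by simp
    _ ≤ ∫ y, u y ∂P₀ := integral_mono (integrable_const 1) hu h

section Mixture

variable {𝒳 : Type} [MeasurableSpace 𝒳] [PseudoMetricSpace 𝒳] {lam : Measure 𝒳}
  [IsBallDifferentiating lam] {α : ℝ} {ι : Type*} [Fintype ι]

theorem isStairNormalized_discreteMeasure [Nonempty 𝒳] {w : ι → ℝ} (hw : ∀ i, 0 ≤ w i)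
    (r : ι → stairExtremal lam α) (hsum : ∀ᵐ x ∂lam, ∑ i, w i * (r i).1.toFun x = 1) :
    IsStairNormalized (discreteMeasure w r) where
  subprob := by
    have := IsBallDifferentiating.ae_neBot (lam := lam)
    obtain ⟨x, hx, hx'⟩ := (hsum.and (ae_all_iff.2 fun i => (r i).1.bounds)).exists
    simp only [discreteMeasure, Measure.finsetSum_apply, Measure.smul_apply, smul_eq_mul,
      measure_univ, mul_one]
    rw [← ENNReal.ofReal_sum_of_nonneg fun i _ => hw i, ENNReal.ofReal_le_one, ← hx]
    exact Finset.sum_le_sum fun i _ => le_mul_of_one_le_right (hw i) (hx' i).1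
  radon := innerRegular_discreteMeasure w r
  normalized := by
    filter_upwards [hsum, ae_all_iff.2 fun i => stairEval_ae (r i).1] with x hx hx'
    rw [integral_discreteMeasure hw r (f := fun r : stairExtremal lam α => stairEval x r.1)
      ((measurable_stairEval x).comp measurable_subtype_coe), ← hx]
    exact Finset.sum_congr rfl fun i _ => by rw [hx' i]

variable {P₀ : Measure 𝒳} [IsProbabilityMeasure P₀] {s : 𝒳 → ℝ} {I : ℝ}

theorem sum_outcomeInfo_le_of_two_valued (hα : 0 ≤ α) (hP : P₀ ≪ lam) (hs : Integrable s P₀)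
    (hI : I ∈ upperBounds (stairObjectives lam α s (modelDensity lam P₀)))
    {w : ι → ℝ} (hw : ∀ i, 0 ≤ w i) {u : ι → 𝒳 → ℝ} (hu : ∀ i, Measurable (u i))
    (hu' : ∀ i x, u i x = 1 ∨ u i x = Real.exp α) (hsum : ∀ x, ∑ i, w i * u i x = 1) :
    ∑ i, w i * outcomeInfo P₀ s (u i) ≤ I := by
  have := IsBallDifferentiating.sigmaFinite (lam := lam)
  have := nonempty_of_isProbabilityMeasure P₀
  choose r hr hru using fun i =>
    exists_mem_stairExtremal_ae_eq (lam := lam) hα (hu i).aestronglyMeasurable (.of_forall (hu' i))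
  have hnorm : IsStairNormalized (discreteMeasure w fun i => ⟨r i, hr i⟩) := by
    refine isStairNormalized_discreteMeasure hw _ ?_
    filter_upwards [ae_all_iff.2 hru] with x hx
    simpa only [hx] using hsum x
  refine le_of_eq_of_le ?_ (hI ⟨_, hnorm, rfl⟩)
  rw [integral_discreteMeasure hw _
    (f := fun r : stairExtremal lam α => stairInfo s (modelDensity lam P₀) r.1)
    ((continuous_stairInfo hP hs).measurable.comp measurable_subtype_coe)]
  refine Finset.sum_congr rfl fun i _ => ?_
  rw [stairInfo_eq_outcomeInfo hP, outcomeInfo_congr_ae (hP.ae_le (hru i))]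

theorem sum_outcomeInfo_le_of_simpleFunc (hα : 0 ≤ α) (hP : P₀ ≪ lam) (hs : Integrable s P₀)
    (hI : I ∈ upperBounds (stairObjectives lam α s (modelDensity lam P₀)))
    {c : ι → ℝ} (hc : ∀ j, 0 ≤ c j) (r : ι → SimpleFunc 𝒳 ℝ)
    (hr : ∀ j x, r j x ∈ Set.Icc 1 (Real.exp α)) (hsum : ∀ x, ∑ j, c j * r j x = 1) :
    ∑ j, c j * outcomeInfo P₀ s (r j) ≤ I := by
  choose κ _ w v hw _ hv hrv using fun j =>
    exists_two_valued_sum_eq (r j) (Real.one_le_exp hα) (hr j)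
  have hv_mem (j k x) : v j k x ∈ Set.Icc 1 (Real.exp α) := by
    rcases hv j k x with h | h <;> simp [h, hα]
  have hv_int (j k) : Integrable (v j k) P₀ := (v j k).integrable_of_isFiniteMeasure
  have hsv_int (j k) : Integrable (fun x => s x * v j k x) P₀ :=
    hs.mul_bdd (c := Real.exp α) (v j k).aestronglyMeasurable (.of_forall fun x => by
      rw [Real.norm_of_nonneg (zero_le_one.trans (hv_mem j k x).1)]
      exact (hv_mem j k x).2)
  calc ∑ j, c j * outcomeInfo P₀ s (r j)
      ≤ ∑ j, c j * ∑ k, w j k * outcomeInfo P₀ s (v j k) := by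
        refine Finset.sum_le_sum fun j _ => mul_le_mul_of_nonneg_left ?_ (hc j)
        rw [show ⇑(r j) = fun x => ∑ k, w j k * v j k x from funext (hrv j)]
        exact outcomeInfo_sum_le _ (fun k _ => hw j k) (fun k _ => hv_int j k)
          (fun k _ => hsv_int j k) fun k _ =>
          integral_pos_of_one_le (hv_int j k) fun x => (hv_mem j k x).1
    _ = ∑ i : Σ j, κ j, c i.1 * w i.1 i.2 * outcomeInfo P₀ s (v i.1 i.2) := by
        simp only [Fintype.sum_sigma, Finset.mul_sum, mul_assoc]
    _ ≤ I := by
        refine sum_outcomeInfo_le_of_two_valued hα hP hs hI (fun i => mul_nonneg (hc _) (hw _ _))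
          (fun i => (v i.1 i.2).measurable) (fun i => hv i.1 i.2) fun x => ?_
        simp only [Fintype.sum_sigma, mul_assoc, ← Finset.mul_sum, ← hrv, hsum]

theorem sum_outcomeInfo_le (hα : 0 ≤ α) (hP : P₀ ≪ lam) (hs : Integrable s P₀)
    (hI : I ∈ upperBounds (stairObjectives lam α s (modelDensity lam P₀)))
    {c : ι → ℝ} (hc : ∀ j, 0 ≤ c j) {r : ι → 𝒳 → ℝ} (hr : ∀ j, Measurable (r j))
    (hr' : ∀ j x, r j x ∈ Set.Icc 1 (Real.exp α)) (hsum : ∀ x, ∑ j, c j * r j x = 1) :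
    ∑ j, c j * outcomeInfo P₀ s (r j) ≤ I := by
  obtain ⟨g, hg, hgsum, hlim⟩ := exists_simpleFunc_tendsto hr hr' hsum
  have hr_int (j : ι) : Integrable (r j) P₀ :=
    .of_mem_Icc 1 (Real.exp α) (hr j).aemeasurable (.of_forall (hr' j))
  have hlim_info (j : ι) :
      Tendsto (fun n => outcomeInfo P₀ s (g n j)) atTop (𝓝 (outcomeInfo P₀ s (r j))) := by
    refine tendsto_outcomeInfo hs (fun n => (g n j).aestronglyMeasurable)
      (C := Real.exp α) (fun n => .of_forall fun x => ?_) (.of_forall (hlim j))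
      (integral_pos_of_one_le (hr_int j) fun x => (hr' j x).1).ne'
    exact (abs_of_nonneg (zero_le_one.trans (hg n j x).1)).trans_le (hg n j x).2
  exact le_of_tendsto' (tendsto_finsetSum _ fun j _ => (hlim_info j).const_mul (c j)) fun n =>
    sum_outcomeInfo_le_of_simpleFunc hα hP hs hI hc (g n) (hg n) (hgsum n)

end Mixture

/-! ### The upper bound -/

section SecondMoment

variable {Z : Type*} [MeasurableSpace Z] {m : Measure Z} {t : Z → ℝ}

theorem integral_two_mul_sub_sq_le_sum [IsFiniteMeasure m] (ht : Integrable t m)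
    (g : SimpleFunc Z ℝ) :
    ∫ z, (2 * g z * t z - g z ^ 2) ∂m
      ≤ ∑ v ∈ g.range, (∫ z in g ⁻¹' {v}, t z ∂m) ^ 2 / m.real (g ⁻¹' {v}) := by
  have hfiber (v : ℝ) : ∫ z in g ⁻¹' {v}, (2 * g z * t z - g z ^ 2) ∂m
      = 2 * v * (∫ z in g ⁻¹' {v}, t z ∂m) - v ^ 2 * m.real (g ⁻¹' {v}) := by
    rw [setIntegral_congr_fun (g := fun z => 2 * v * t z - v ^ 2) (g.measurableSet_fiber v)
        (by rintro z rfl; rfl), integral_sub (ht.integrableOn.const_mul _) (integrable_const _),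
      integral_const_mul, setIntegral_const, smul_eq_mul, mul_comm (v ^ 2)]
  have hunion : ⋃ v ∈ g.range, g ⁻¹' {v} = Set.univ :=
    Set.iUnion₂_eq_univ_iff.2 fun z => ⟨g z, g.mem_range_self z, rfl⟩
  have hint : Integrable (fun z => 2 * g z * t z - g z ^ 2) m := by
    obtain ⟨C, hC⟩ := (2 * g).exists_forall_norm_le
    exact (ht.bdd_mul (c := C) (2 * g).aestronglyMeasurable (.of_forall hC)).sub
      (g ^ 2).integrable_of_isFiniteMeasure
  rw [← setIntegral_univ, ← hunion, integral_biUnion_finset _ (fun v _ => g.measurableSet_fiber v)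
    (fun v _ w _ hvw => Disjoint.preimage _ (Set.disjoint_singleton.2 hvw))
    fun v _ => hint.integrableOn]
  refine Finset.sum_le_sum fun v _ => (hfiber v).trans_le ?_
  rcases measureReal_nonneg.eq_or_lt with h | h
  · have hzero : m.restrict (g ⁻¹' {v}) = 0 :=
      Measure.restrict_eq_zero.2 ((measureReal_eq_zero_iff).1 h.symm)
    simp [← h, hzero]
  · exact two_mul_sub_sq_mul_le_sq_div v _ h

theorem integral_sq_le_of_simpleFunc {I : ℝ} (ht : MemLp t 2 m)
    (h : ∀ g : SimpleFunc Z ℝ, ∫ z, (2 * g z * t z - g z ^ 2) ∂m ≤ I) :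
    ∫ z, t z ^ 2 ∂m ≤ I := by
  refine le_of_forall_pos_le_add fun ε hε => ?_
  obtain ⟨g, hg, hgL⟩ := ht.exists_simpleFunc_eLpNorm_sub_lt (by simp)
    (ε := ENNReal.ofReal (√ε)) (by simpa using hε)
  have hsub : MemLp (t - ⇑g) 2 m := ht.sub hgL
  have hsmall : ∫ z, (t z - g z) ^ 2 ∂m ≤ ε := by
    rw [hsub.eLpNorm_eq_integral_rpow_norm two_ne_zero (by simp)] at hg
    have hlt := (ENNReal.ofReal_lt_ofReal_iff (Real.sqrt_pos.2 hε)).1 hg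
    simp only [ENNReal.toReal_ofNat, Real.rpow_ofNat, Pi.sub_apply, Real.norm_eq_abs, sq_abs,
      ← one_div, ← Real.sqrt_eq_rpow] at hlt
    exact ((Real.sqrt_lt_sqrt_iff (integral_nonneg fun z => sq_nonneg _)).1 hlt).le
  calc ∫ z, t z ^ 2 ∂m = ∫ z, ((2 * g z * t z - g z ^ 2) + (t z - g z) ^ 2) ∂m := by
        simp only [sub_sq]
        ring_nf
    _ = ∫ z, (2 * g z * t z - g z ^ 2) ∂m + ∫ z, (t z - g z) ^ 2 ∂m := by
        refine integral_add ?_ hsub.integrable_sq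
        refine (ht.integrable_sq.sub hsub.integrable_sq).congr (.of_forall fun z => ?_)
        simp only [Pi.sub_apply]
        ring
    _ ≤ I + ε := add_le_add (h g) hsmall

end SecondMoment

section Bind

variable {𝒳 Z : Type} [MeasurableSpace 𝒳] [MeasurableSpace Z] {Q : Kernel 𝒳 Z} [IsMarkovKernel Q]

theorem measureReal_bind (P : Measure 𝒳) {A : Set Z} (hA : MeasurableSet A) :
    (P.bind Q).real A = ∫ x, (Q x).real A ∂P := by
  rw [measureReal_def, Measure.bind_apply hA Q.measurable.aemeasurable]
  exact (integral_toReal (Q.measurable_coe hA).aemeasurable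
    (.of_forall fun x => measure_lt_top _ _)).symm

variable {lam : Measure 𝒳} [SigmaFinite lam] {P : ℝ → Measure 𝒳} {θ₀ : ℝ} {s : 𝒳 → ℝ}
  {ν : Measure Z} [SigmaFinite ν] {t : Z → ℝ}

theorem IsDQMScore.setIntegral_bind (hs : IsDQMScore lam P θ₀ s) (hP : IsDominatedNear lam P θ₀)
    (ht : IsDQMScore ν (fun θ => (P θ).bind Q) θ₀ t)
    (hPQ : IsDominatedNear ν (fun θ => (P θ).bind Q) θ₀) {A : Set Z} (hA : MeasurableSet A) :
    ∫ z in A, t z ∂((P θ₀).bind Q) = ∫ x, s x * (Q x).real A ∂P θ₀ := by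
  have hderiv_public := ht.hasDerivAt_integral hPQ (u := A.indicator 1)
    (measurable_one.indicator hA).aestronglyMeasurable (C := 1)
    (.of_forall fun z => by by_cases h : z ∈ A <;> simp [h])
  have hderiv_private := hs.hasDerivAt_integral hP (u := fun x => (Q x).real A)
    (Q.measurable_coe hA).ennreal_toReal.aestronglyMeasurable (C := 1)
    (.of_forall fun x => by rw [abs_of_nonneg measureReal_nonneg]; exact measureReal_le_one)
  simp only [integral_indicator_one hA, measureReal_bind _ hA] at hderiv_public
  rw [← hderiv_public.unique hderiv_private, ← integral_indicator hA]
  refine integral_congr_ae (.of_forall fun z => ?_)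
  by_cases h : z ∈ A <;> simp [h]

theorem IsDQMScore.outcomeInfo_measureReal (hs : IsDQMScore lam P θ₀ s)
    (hP : IsDominatedNear lam P θ₀) (ht : IsDQMScore ν (fun θ => (P θ).bind Q) θ₀ t)
    (hPQ : IsDominatedNear ν (fun θ => (P θ).bind Q) θ₀) {A : Set Z} (hA : MeasurableSet A) :
    outcomeInfo (P θ₀) s (fun x => (Q x).real A)
      = (∫ z in A, t z ∂((P θ₀).bind Q)) ^ 2 / ((P θ₀).bind Q).real A := by
  rw [outcomeInfo, hs.setIntegral_bind hP ht hPQ hA, measureReal_bind _ hA]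

end Bind

section UpperBound

theorem exists_eq_const_mul_mem_Icc {𝒳 : Type*} [MeasurableSpace 𝒳] [Nonempty 𝒳] {q : 𝒳 → ℝ}
    (hq : Measurable q) (hq0 : ∀ x, 0 ≤ q x) {C : ℝ} (hC : 1 ≤ C)
    (hqC : ∀ x x', q x ≤ C * q x') :
    ∃ (c : ℝ) (r : 𝒳 → ℝ), 0 ≤ c ∧ Measurable r ∧ (∀ x, r x ∈ Set.Icc 1 C) ∧
      q = fun x => c * r x := by
  have hC0 : 0 < C := one_pos.trans_le hC
  have hbdd : BddBelow (Set.range q) := ⟨0, Set.forall_mem_range.2 hq0⟩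
  have hinf_le (x : 𝒳) : ⨅ x, q x ≤ q x := ciInf_le hbdd x
  have hle_inf (x : 𝒳) : q x ≤ C * ⨅ x, q x := by
    rw [← div_le_iff₀' hC0]
    exact le_ciInf fun x' => (div_le_iff₀' hC0).2 (hqC x x')
  rcases (Real.iInf_nonneg hq0).eq_or_lt with h | h
  · refine ⟨0, fun _ => 1, le_rfl, measurable_const, fun _ => ⟨le_rfl, hC⟩, funext fun x => ?_⟩
    have := hle_inf x
    rw [← h, mul_zero] at this
    rw [zero_mul]
    exact le_antisymm this (hq0 x)
  · exact ⟨⨅ x, q x, fun x => q x / ⨅ x, q x, h.le, hq.div_const _,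
      fun x => ⟨(one_le_div h).2 (hinf_le x), (div_le_iff₀ h).2 (hle_inf x)⟩,
      funext fun x => (mul_div_cancel₀ _ h.ne').symm⟩

variable {𝒳 : Type} [MeasurableSpace 𝒳] [PseudoMetricSpace 𝒳] {lam : Measure 𝒳}
  [IsBallDifferentiating lam] {α : ℝ} {s : 𝒳 → ℝ} {I : ℝ}

theorem sum_outcomeInfo_le_of_ldp {P₀ : Measure 𝒳} [IsProbabilityMeasure P₀] (hα : 0 ≤ α)
    (hP : P₀ ≪ lam) (hs : Integrable s P₀)
    (hI : I ∈ upperBounds (stairObjectives lam α s (modelDensity lam P₀)))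
    {ι : Type*} [Fintype ι] {q : ι → 𝒳 → ℝ} (hq : ∀ j, Measurable (q j))
    (hq0 : ∀ j x, 0 ≤ q j x) (hqα : ∀ j x x', q j x ≤ Real.exp α * q j x')
    (hsum : ∀ x, ∑ j, q j x = 1) : ∑ j, outcomeInfo P₀ s (q j) ≤ I := by
  have := nonempty_of_isProbabilityMeasure P₀
  choose c r hc hr hr' hcr using fun j =>
    exists_eq_const_mul_mem_Icc (hq j) (hq0 j) (Real.one_le_exp hα) (hqα j)
  simp only [hcr, outcomeInfo_const_mul] at hsum ⊢
  exact sum_outcomeInfo_le hα hP hs hI hc hr hr' hsum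

variable {P : ℝ → Measure 𝒳} {θ₀ : ℝ}

theorem IsDQMScore.integral_sq_bind_le (hα : 0 ≤ α) (hs : IsDQMScore lam P θ₀ s)
    (hP : IsDominatedNear lam P θ₀)
    (hI : I ∈ upperBounds (stairObjectives lam α s (modelDensity lam (P θ₀))))
    {Z : Type} [MeasurableSpace Z] {Q : Kernel 𝒳 Z} [IsMarkovKernel Q] (hQ : IsLDP α Q)
    {ν : Measure Z} [SigmaFinite ν] {t : Z → ℝ} (ht : IsDQMScore ν (fun θ => (P θ).bind Q) θ₀ t)
    (hPQ : IsDominatedNear ν (fun θ => (P θ).bind Q) θ₀) :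
    ∫ z, t z ^ 2 ∂((P θ₀).bind Q) ≤ I := by
  have := IsBallDifferentiating.sigmaFinite (lam := lam)
  have := hP.self_of_nhds.1
  refine integral_sq_le_of_simpleFunc
    ((memLp_two_iff_integrable_sq ht.1.aestronglyMeasurable).2 (ht.integrable_sq hPQ)) fun g =>
    (integral_two_mul_sub_sq_le_sum (ht.integrable hPQ) g).trans ?_
  simp only [← hs.outcomeInfo_measureReal hP ht hPQ (g.measurableSet_fiber _)]
  rw [← Finset.sum_coe_sort]
  refine sum_outcomeInfo_le_of_ldp hα hP.self_of_nhds.2 (hs.integrable hP) hI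
    (fun v => (Q.measurable_coe (g.measurableSet_fiber _)).ennreal_toReal)
    (fun v x => measureReal_nonneg) (fun v x x' => ?_) fun x => ?_
  · have := ENNReal.toReal_mono (ENNReal.mul_ne_top ENNReal.ofReal_ne_top (measure_ne_top _ _))
      (hQ x x' _ (g.measurableSet_fiber v))
    rwa [ENNReal.toReal_mul, ENNReal.toReal_ofReal (Real.exp_nonneg _)] at this
  · rw [Finset.sum_coe_sort g.range fun v => (Q x).real (g ⁻¹' {v}),
      sum_measureReal_preimage_singleton _ fun v _ => g.measurableSet_fiber v,
      SimpleFunc.coe_range, Set.preimage_range, probReal_univ]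

theorem mem_upperBounds_privateFisherInfos {Θ : Set ℝ} (hα : 0 ≤ α) (hs : IsDQMScore lam P θ₀ s)
    (hθ₀ : θ₀ ∈ interior Θ) (hP : ∀ θ ∈ Θ, IsProbabilityMeasure (P θ))
    (hdom : ∀ θ ∈ Θ, P θ ≪ lam)
    (hI : I ∈ upperBounds (stairObjectives lam α s (modelDensity lam (P θ₀)))) :
    I ∈ upperBounds (privateFisherInfos α Θ P θ₀) := by
  rintro _ ⟨Z, _, _, _, _, Q, _, hQ, ν, _, hν, t, ht, rfl⟩
  have hnear := isDominatedNear_of_mem_interior hθ₀ hP hdom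
  refine hs.integral_sq_bind_le hα hnear hI hQ ht (isDominatedNear_of_mem_interior hθ₀ ?_ hν)
  intro θ hθ
  have := hP θ hθ
  infer_instance

end UpperBound

/-! ### Mechanisms with a density -/

section DensityKernel

variable {𝒳 Z : Type} [MeasurableSpace 𝒳] [MeasurableSpace Z] {ν : Measure Z} [IsFiniteMeasure ν]
  {u : Z → 𝒳 → ℝ} {α : ℝ}

/-- The mechanism whose output has density `u · x` with respect to `ν` when the private value
is `x`. The public value comes first, so that `u z` is the random variable whose mean is the
density of the public law at `z`. -/
noncomputable def densityKernel (ν : Measure Z) [IsFiniteMeasure ν] (u : Z → 𝒳 → ℝ) :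
    Kernel 𝒳 Z :=
  (Kernel.const 𝒳 ν).withDensity fun x z => ENNReal.ofReal (u z x)

theorem densityKernel_apply (hu : Measurable (Function.uncurry u)) (x : 𝒳) (A : Set Z) :
    densityKernel ν u x A = ∫⁻ z in A, ENNReal.ofReal (u z x) ∂ν := by
  rw [densityKernel, Kernel.withDensity_apply' _ (hu.comp measurable_swap).ennreal_ofReal,
    Kernel.const_apply]

theorem isMarkovKernel_densityKernel (hu : Measurable (Function.uncurry u))
    (hmass : ∀ x, ∫⁻ z, ENNReal.ofReal (u z x) ∂ν = 1) : IsMarkovKernel (densityKernel ν u) :=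
  ⟨fun x => ⟨by rw [densityKernel_apply hu, Measure.restrict_univ, hmass]⟩⟩

theorem isLDP_densityKernel (hu : Measurable (Function.uncurry u))
    (hratio : ∀ z x x', u z x ≤ Real.exp α * u z x') : IsLDP α (densityKernel ν u) := by
  intro x x' A _
  rw [densityKernel_apply hu, densityKernel_apply hu,
    ← lintegral_const_mul' _ _ ENNReal.ofReal_ne_top]
  refine lintegral_mono fun z => ?_
  rw [← ENNReal.ofReal_mul (Real.exp_nonneg _)]
  exact ENNReal.ofReal_le_ofReal (hratio z x x')

theorem bind_densityKernel (hu : Measurable (Function.uncurry u)) {P : Measure 𝒳} [SFinite P]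
    (hint : ∀ z, Integrable (u z) P) (hnonneg : ∀ z x, 0 ≤ u z x) :
    P.bind (densityKernel ν u) = ν.withDensity fun z => ENNReal.ofReal (∫ x, u z x ∂P) := by
  ext A hA
  rw [Measure.bind_apply hA (Kernel.aemeasurable _), withDensity_apply _ hA]
  simp only [densityKernel_apply hu]
  rw [lintegral_lintegral_swap (hu.comp measurable_swap).ennreal_ofReal.aemeasurable]
  exact lintegral_congr fun z =>
    (ofReal_integral_eq_lintegral_ofReal (hint z) (.of_forall (hnonneg z))).symm

variable {lam : Measure 𝒳} [SigmaFinite lam] {P : ℝ → Measure 𝒳} {θ₀ : ℝ} {s : 𝒳 → ℝ} {Θ : Set ℝ}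

theorem IsDQMScore.integral_outcomeInfo_mem_privateFisherInfos [TopologicalSpace Z] [PolishSpace Z]
    [BorelSpace Z] (hs : IsDQMScore lam P θ₀ s) (hθ₀ : θ₀ ∈ interior Θ)
    (hP : ∀ θ ∈ Θ, IsProbabilityMeasure (P θ)) (hdom : ∀ θ ∈ Θ, P θ ≪ lam)
    (hu : Measurable (Function.uncurry u)) (hu' : ∀ z x, 1 ≤ u z x ∧ u z x ≤ Real.exp α)
    (hmass : ∀ x, ∫⁻ z, ENNReal.ofReal (u z x) ∂ν = 1) :
    ∫ z, outcomeInfo (P θ₀) s (u z) ∂ν ∈ privateFisherInfos α Θ P θ₀ := by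
  have hratio (z : Z) (x x' : 𝒳) : u z x ≤ Real.exp α * u z x' :=
    (hu' z x).2.trans (le_mul_of_one_le_right (Real.exp_nonneg _) (hu' z x').1)
  have hmeas (z : Z) : Measurable (u z) := hu.of_uncurry_left
  refine ⟨Z, inferInstance, inferInstance, inferInstance, inferInstance, densityKernel ν u,
    isMarkovKernel_densityKernel hu hmass, isLDP_densityKernel hu hratio,
    hs.hasFisherInfo_of_eq_withDensity hθ₀ hP hdom (fun z => (hmeas z).aestronglyMeasurable)
      one_pos (fun z => .of_forall (hu' z)) (fun θ hθ => ?_) ?_ fun θ hθ => ?_⟩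
  · have := hP θ hθ
    exact hu.stronglyMeasurable.integral_prod_right.measurable
  · have := hP θ₀ (interior_subset hθ₀)
    have hsu : Measurable (Function.uncurry fun z x => s x * u z x) :=
      (hs.1.comp measurable_snd).mul hu
    exact hsu.stronglyMeasurable.integral_prod_right.measurable
  · have := hP θ hθ
    have hnonneg (z : Z) (x : 𝒳) : 0 ≤ u z x := zero_le_one.trans (hu' z x).1
    refine bind_densityKernel hu (fun z => ?_) hnonneg
    refine .of_bound (hmeas z).aestronglyMeasurable (Real.exp α) (.of_forall fun x => ?_)
    rw [Real.norm_of_nonneg (hnonneg z x)]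
    exact (hu' z x).2

theorem IsDQMScore.binary_mem_privateFisherInfos (hs : IsDQMScore lam P θ₀ s)
    (hθ₀ : θ₀ ∈ interior Θ) (hP : ∀ θ ∈ Θ, IsProbabilityMeasure (P θ))
    (hdom : ∀ θ ∈ Θ, P θ ≪ lam) {v : 𝒳 → ℝ} (hv : Measurable v)
    (hv' : ∀ x, 1 ≤ v x ∧ v x ≤ Real.exp α) :
    1 / (Real.exp α + 1) * (outcomeInfo (P θ₀) s v
      + outcomeInfo (P θ₀) s fun x => Real.exp α + 1 - v x) ∈ privateFisherInfos α Θ P θ₀ := by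
  set u : Bool → 𝒳 → ℝ := fun b x => bif b then v x else Real.exp α + 1 - v x
  set ν : Measure Bool := ENNReal.ofReal (1 / (Real.exp α + 1)) • Measure.count
  have : IsFiniteMeasure ν := Measure.smul_finite _ ENNReal.ofReal_ne_top
  have hν (f : Bool → ℝ) : ∫ b, f b ∂ν = 1 / (Real.exp α + 1) * (f true + f false) := by
    rw [integral_smul_measure, integral_count, Fintype.sum_bool,
      ENNReal.toReal_ofReal (by positivity), smul_eq_mul]
  have hu : Measurable (Function.uncurry u) := measurable_from_prod_countable_right fun b => by
    cases b
    exacts [measurable_const.sub hv, hv]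
  have hu' (b : Bool) (x : 𝒳) : 1 ≤ u b x ∧ u b x ≤ Real.exp α := by
    cases b
    · simp only [u, cond_false]
      constructor <;> linarith [hv' x]
    · exact hv' x
  have hmass (x : 𝒳) : ∫⁻ b, ENNReal.ofReal (u b x) ∂ν = 1 := by
    rw [← ofReal_integral_eq_lintegral_ofReal .of_finite
      (.of_forall fun b => zero_le_one.trans (hu' b x).1), hν, ENNReal.ofReal_eq_one]
    simp only [u, cond_true, cond_false]
    field_simp
    ring
  have hinfo := hs.integral_outcomeInfo_mem_privateFisherInfos hθ₀ hP hdom hu hu' hmass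
  rw [hν] at hinfo
  exact hinfo

theorem stairInfoSym_mem_privateFisherInfos (hα : 0 ≤ α) (hs : IsDQMScore lam P θ₀ s)
    (hθ₀ : θ₀ ∈ interior Θ) (hP : ∀ θ ∈ Θ, IsProbabilityMeasure (P θ))
    (hdom : ∀ θ ∈ Θ, P θ ≪ lam) (r : StairBox lam α) :
    2 / (Real.exp α + 1) * stairInfoSym s (modelDensity lam (P θ₀)) r
      ∈ privateFisherInfos α Θ P θ₀ := by
  have hdom₀ := hdom θ₀ (interior_subset hθ₀)
  have := hP θ₀ (interior_subset hθ₀)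
  obtain ⟨v, hv, hv', hrv⟩ := r.exists_representative hα
  have hswap : (stairSwap r).toFun =ᵐ[lam] fun x => Real.exp α + 1 - v x := by
    filter_upwards [toFun_stairSwap_ae r, hrv] with x hx hx'
    rw [hx, hx']
  convert hs.binary_mem_privateFisherInfos hθ₀ hP hdom hv hv' using 1
  rw [stairInfoSym, stairInfo_eq_outcomeInfo hdom₀, stairInfo_eq_outcomeInfo hdom₀,
    outcomeInfo_congr_ae (hdom₀.ae_eq hrv), outcomeInfo_congr_ae (hdom₀.ae_eq hswap)]
  ring

end DensityKernel

/-! ### Symmetric maximizers -/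

section LevelSets

variable {𝒳 : Type} [MeasurableSpace 𝒳] {lam : Measure 𝒳} [SigmaFinite lam] {α : ℝ}
  {P₀ : Measure 𝒳} {r : StairBox lam α}

theorem integral_mul_of_mem_stairExtremal [IsFiniteMeasure P₀] (hP : P₀ ≪ lam)
    (hr : r ∈ stairExtremal lam α) {f : 𝒳 → ℝ} (hf : Integrable f P₀) :
    ∫ x, f x * r.toFun x ∂P₀ = ∫ x, f x ∂P₀
      + (Real.exp α - 1) * ∫ x in stairLevel r, f x * modelDensity lam P₀ x ∂lam := by
  have hlevel : MeasurableSet (stairLevel r) := r.measurable_toFun (measurableSet_singleton _)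
  have hindicator : ∫ x in stairLevel r, f x * modelDensity lam P₀ x ∂lam
      = ∫ x, (stairLevel r).indicator f x ∂P₀ := by
    rw [← integral_indicator hlevel, ← integral_mul_modelDensity hP]
    simp only [Set.indicator_mul_left]
  rw [hindicator, ← integral_const_mul,
    ← integral_add hf ((hf.indicator hlevel).const_mul _)]
  have hr' : ∀ᵐ x ∂lam, r.toFun x = 1 ∨ r.toFun x = Real.exp α := hr
  refine integral_congr_ae ?_
  filter_upwards [hP.ae_le hr'] with x hx
  by_cases hxr : x ∈ stairLevel r
  · rw [Set.indicator_of_mem hxr, show r.toFun x = Real.exp α from hxr]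
    ring
  · rw [Set.indicator_of_notMem hxr, hx.resolve_right hxr]
    ring

theorem integral_of_mem_stairExtremal [IsProbabilityMeasure P₀] (hP : P₀ ≪ lam)
    (hr : r ∈ stairExtremal lam α) :
    ∫ x, r.toFun x ∂P₀
      = 1 + (Real.exp α - 1) * ∫ x in stairLevel r, modelDensity lam P₀ x ∂lam := by
  simpa using integral_mul_of_mem_stairExtremal hP hr (integrable_const 1)

theorem stairInfoSym_of_mem_stairExtremal [IsProbabilityMeasure P₀] (hP : P₀ ≪ lam) {s : 𝒳 → ℝ}
    (hs : Integrable s P₀) (hs₀ : ∫ x, s x ∂P₀ = 0) (hr : r ∈ stairExtremal lam α) :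
    stairInfoSym s (modelDensity lam P₀) r =
      (Real.exp α - 1) ^ 2 * (Real.exp α + 1) / 2 *
        ((∫ x in stairLevel r, s x * modelDensity lam P₀ x ∂lam) ^ 2 /
          ((Real.exp α - (Real.exp α - 1) * ∫ x in stairLevel r, modelDensity lam P₀ x ∂lam) *
            (1 + (Real.exp α - 1) * ∫ x in stairLevel r, modelDensity lam P₀ x ∂lam))) := by
  set a := ∫ x in stairLevel r, modelDensity lam P₀ x ∂lam
  set b := ∫ x in stairLevel r, s x * modelDensity lam P₀ x ∂lam
  have hden : ∫ x, r.toFun x ∂P₀ = 1 + (Real.exp α - 1) * a := integral_of_mem_stairExtremal hP hr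
  have hnum : ∫ x, s x * r.toFun x ∂P₀ = (Real.exp α - 1) * b := by
    rw [integral_mul_of_mem_stairExtremal hP hr hs, hs₀, zero_add]
  have hden' : ∫ x, (stairSwap r).toFun x ∂P₀ = Real.exp α - (Real.exp α - 1) * a := by
    rw [integral_stairSwap hP, hden]
    ring
  have hnum' : ∫ x, s x * (stairSwap r).toFun x ∂P₀ = -((Real.exp α - 1) * b) := by
    rw [integral_mul_stairSwap hP r hs, hs₀, hnum]
    ring
  have hpos := r.integral_pos hP
  have hpos' := (stairSwap r).integral_pos hP
  rw [stairInfoSym, stairInfo_eq_outcomeInfo hP, stairInfo_eq_outcomeInfo hP, outcomeInfo,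
    outcomeInfo, hden, hnum, hden', hnum']
  rw [hden] at hpos
  rw [hden'] at hpos'
  field_simp
  ring

end LevelSets

section Maximizer

variable {𝒳 : Type} [MeasurableSpace 𝒳] [PseudoMetricSpace 𝒳] {lam : Measure 𝒳}
  {α : ℝ} {μ : Measure (stairExtremal lam α)}

theorem IsStairMaximizer.isGreatest {s p : 𝒳 → ℝ} (hμ : IsStairMaximizer s p μ) :
    IsGreatest (stairObjectives lam α s p) (∫ r, stairInfo s p r.1 ∂μ) := by
  refine ⟨⟨μ, hμ.1, rfl⟩, ?_⟩
  rintro _ ⟨μ', hμ', rfl⟩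
  exact hμ.2 μ' hμ'

variable [IsBallDifferentiating lam]

theorem IsStairNormalized.ae_neBot [Nonempty 𝒳] (hμ : IsStairNormalized μ) : (ae μ).NeBot := by
  have := IsBallDifferentiating.ae_neBot (lam := lam)
  obtain ⟨x, hx⟩ := hμ.normalized.exists
  rw [MeasureTheory.ae_neBot]
  rintro rfl
  simp at hx

theorem stairPublicLaw_eq_withDensity (μ : Measure (stairExtremal lam α)) {P₀ : Measure 𝒳}
    [IsProbabilityMeasure P₀] (hP : P₀ ≪ lam) :
    stairPublicLaw μ P₀ = μ.withDensity fun r => ENNReal.ofReal (∫ x, r.1.toFun x ∂P₀) := by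
  rw [stairPublicLaw]
  congr 1 with r
  have hint : Integrable r.1.toFun P₀ := .of_integral_ne_zero (r.1.integral_pos hP).ne'
  rw [ofReal_integral_eq_lintegral_ofReal hint
    (hP.ae_le (r.1.bounds.mono fun x hx => zero_le_one.trans hx.1))]
  refine lintegral_congr_ae ?_
  filter_upwards [hP.ae_le (stairEval_ae r.1)] with x hx
  rw [hx]

theorem IsDQMScore.hasFisherInfo_stairPublicLaw {Θ : Set ℝ} {θ₀ : ℝ} {P : ℝ → Measure 𝒳}
    {s : 𝒳 → ℝ} (hs : IsDQMScore lam P θ₀ s) (hθ₀ : θ₀ ∈ interior Θ)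
    (hP : ∀ θ ∈ Θ, IsProbabilityMeasure (P θ)) (hdom : ∀ θ ∈ Θ, P θ ≪ lam)
    (μ : Measure (stairExtremal lam α)) [IsFiniteMeasure μ] :
    HasFisherInfo Θ (fun θ => stairPublicLaw μ (P θ)) θ₀
      (∫ r, stairInfo s (modelDensity lam (P θ₀)) r.1 ∂μ) := by
  have := IsBallDifferentiating.sigmaFinite (lam := lam)
  have hmem : θ₀ ∈ Θ := interior_subset hθ₀
  have := hP θ₀ hmem
  have hint := hs.integrable (isDominatedNear_of_mem_interior hθ₀ hP hdom)
  simp only [stairInfo_eq_outcomeInfo (hdom θ₀ hmem)]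
  refine hs.hasFisherInfo_of_eq_withDensity hθ₀ hP hdom
    (fun r => r.1.measurable_toFun.aestronglyMeasurable) one_pos (fun r => r.1.bounds)
    (fun θ hθ => ?_)
    ((StairBox.continuous_integral_mul (hdom θ₀ hmem) hint).measurable.comp measurable_subtype_coe)
    fun θ hθ => ?_
  · have := hP θ hθ
    exact (StairBox.continuous_integral (hdom θ hθ)).measurable.comp measurable_subtype_coe
  · have := hP θ hθ
    exact stairPublicLaw_eq_withDensity μ (hdom θ hθ)

theorem integrable_stairInfoSym_and_integral_eq {P₀ : Measure 𝒳} [IsProbabilityMeasure P₀]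
    (hP : P₀ ≪ lam) {s : 𝒳 → ℝ} (hs : Integrable s P₀) [IsFiniteMeasure μ]
    (hsymm : μ.map stairSwapE = μ) :
    Integrable (fun r => stairInfoSym s (modelDensity lam P₀) r.1) μ ∧
      ∫ r, stairInfoSym s (modelDensity lam P₀) r.1 ∂μ
        = ∫ r, stairInfo s (modelDensity lam P₀) r.1 ∂μ := by
  have := IsBallDifferentiating.sigmaFinite (lam := lam)
  set i : stairExtremal lam α → ℝ := fun r => stairInfo s (modelDensity lam P₀) r.1
  have hi : Integrable i μ := integrable_stairInfo hP hs μ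
  have hpres : MeasurePreserving stairSwapE μ μ := ⟨measurable_stairSwapE, hsymm⟩
  have hi' : Integrable (fun r => i (stairSwapE r)) μ := hpres.integrable_comp_of_integrable hi
  have hswap : ∫ r, i (stairSwapE r) ∂μ = ∫ r, i r ∂μ := by
    rw [← integral_map measurable_stairSwapE.aemeasurable
      (hsymm.symm ▸ hi.aestronglyMeasurable), hsymm]
  refine ⟨(hi.add hi').const_mul _, ?_⟩
  calc _ = 1 / 2 * ∫ r, (i r + i (stairSwapE r)) ∂μ := integral_const_mul _ _
    _ = ∫ r, i r ∂μ := by rw [integral_add hi hi', hswap]; ring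

theorem IsStairNormalized.stairInfoSym_ae_eq {P₀ : Measure 𝒳} [IsProbabilityMeasure P₀]
    (hP : P₀ ≪ lam) {s : 𝒳 → ℝ} (hs : Integrable s P₀) (hμ : IsStairNormalized μ)
    (hsymm : μ.map stairSwapE = μ) {m : ℝ}
    (hm : 2 / (Real.exp α + 1) * m = ∫ r, stairInfo s (modelDensity lam P₀) r.1 ∂μ)
    (hle : ∀ r : stairExtremal lam α, stairInfoSym s (modelDensity lam P₀) r.1 ≤ m) :
    ∀ᵐ r ∂μ, stairInfoSym s (modelDensity lam P₀) r.1 = m := by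
  have := nonempty_of_isProbabilityMeasure P₀
  have := hμ.isFiniteMeasure
  have := IsBallDifferentiating.sigmaFinite (lam := lam)
  obtain ⟨hint, hintegral⟩ := integrable_stairInfoSym_and_integral_eq hP hs hsymm
  have hm₀ : 0 ≤ m := by
    refine nonneg_of_mul_nonneg_right (a := 2 / (Real.exp α + 1)) ?_ (by positivity)
    rw [hm]
    exact integral_nonneg fun r => stairInfo_nonneg hP s r.1
  refine (integral_eq_iff_of_ae_le hint (integrable_const m) (.of_forall hle)).1
    (le_antisymm (integral_mono hint (integrable_const m) hle) ?_)
  calc ∫ _, m ∂μ = μ.real Set.univ * m := by rw [integral_const, smul_eq_mul]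
    _ ≤ 2 / (Real.exp α + 1) * m := by gcongr; exact hμ.mass_le hsymm
    _ = ∫ r, stairInfoSym s (modelDensity lam P₀) r.1 ∂μ := by rw [hm, hintegral]

end Maximizer

theorem theorem1_general {𝒳 : Type} [MeasurableSpace 𝒳] [PseudoMetricSpace 𝒳] (lam : Measure 𝒳)
    [IsBallDifferentiating lam] (Θ : Set ℝ) (θ₀ : ℝ) (hθ₀ : θ₀ ∈ interior Θ)
    (P : ℝ → Measure 𝒳) (hP : ∀ θ ∈ Θ, IsProbabilityMeasure (P θ))
    (hPdom : ∀ θ ∈ Θ, P θ ≪ lam)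
    (p : 𝒳 → ℝ) (hp : p = modelDensity lam (P θ₀))
    (s : 𝒳 → ℝ) (hs : IsDQMScore lam P θ₀ s)
    (α : ℝ) (hα : 0 ≤ α)
    (μ : Measure (stairExtremal lam α)) (hμ : IsStairMaximizer s p μ)
    (hsymm : μ.map stairSwapE = μ) :
    (∃ c : ℝ, ∀ᵐ r ∂μ, stairInfoSym s p r.1 = c) ∧
    (∃ m : ℝ,
      IsGreatest (Set.range (fun r : StairBox lam α => stairInfoSym s p r)) m ∧
      IsGreatest (privateFisherInfos α Θ P θ₀) (2 / (Real.exp α + 1) * m) ∧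
      IsGreatest (stairObjectives lam α s p) (2 / (Real.exp α + 1) * m) ∧
      HasFisherInfo Θ (fun θ => stairPublicLaw μ (P θ)) θ₀ (2 / (Real.exp α + 1) * m)) ∧
    (∀ r ∈ stairExtremal lam α,
      stairInfoSym s p r =
        (Real.exp α - 1) ^ 2 * (Real.exp α + 1) / 2 *
          ((∫ x in stairLevel r, s x * p x ∂lam) ^ 2 /
            ((Real.exp α - (Real.exp α - 1) * ∫ x in stairLevel r, p x ∂lam) *
              (1 + (Real.exp α - 1) * ∫ x in stairLevel r, p x ∂lam)))) := by
  subst hp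
  have hdom₀ := hPdom θ₀ (interior_subset hθ₀)
  have := hP θ₀ (interior_subset hθ₀)
  have := nonempty_of_isProbabilityMeasure (P θ₀)
  have := hμ.1.isFiniteMeasure
  have := hμ.1.ae_neBot
  have := IsBallDifferentiating.sigmaFinite (lam := lam)
  have hnear := isDominatedNear_of_mem_interior hθ₀ hP hPdom
  have hint := hs.integrable hnear
  have hobj := hμ.isGreatest
  have hfisher := hs.hasFisherInfo_stairPublicLaw hθ₀ hP hPdom μ
  obtain ⟨m, hm⟩ := (mul_left_surjective₀ (by positivity : 2 / (Real.exp α + 1) ≠ 0))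
    (∫ r, stairInfo s (modelDensity lam (P θ₀)) r.1 ∂μ)
  simp only at hm
  rw [← hm] at hobj hfisher
  have hprivate := stairInfoSym_mem_privateFisherInfos hα hs hθ₀ hP hPdom
  have hupper := mem_upperBounds_privateFisherInfos hα hs hθ₀ hP hPdom hobj.2
  have hle (r : StairBox lam α) : stairInfoSym s (modelDensity lam (P θ₀)) r ≤ m :=
    le_of_mul_le_mul_left (hupper (hprivate r)) (by positivity)
  have hconst := hμ.1.stairInfoSym_ae_eq hdom₀ hint hsymm hm fun r => hle r.1
  obtain ⟨r₀, hr₀⟩ := hconst.exists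
  exact ⟨⟨m, hconst⟩, ⟨m, ⟨⟨r₀.1, hr₀⟩, Set.forall_mem_range.2 hle⟩,
    ⟨hr₀ ▸ hprivate r₀.1, hupper⟩, hobj, hfisher⟩,
    fun _ hr => stairInfoSym_of_mem_stairExtremal hdom₀ hint (hs.integral_eq_zero hnear) hr⟩

theorem theorem1 {d : ℕ} (X : Set (EuclideanSpace ℝ (Fin d))) (hX : IsOpen X)
    (Θ : Set ℝ) (θ₀ : ℝ) (hθ₀ : θ₀ ∈ interior Θ)
    (P : ℝ → Measure X) (hP : ∀ θ ∈ Θ, IsProbabilityMeasure (P θ))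
    (hPdom : ∀ θ ∈ Θ, P θ ≪ lebesgueOn X)
    (p : X → ℝ) (hp : p = modelDensity (lebesgueOn X) (P θ₀))
    (s : X → ℝ) (hs : IsDQMScore (lebesgueOn X) P θ₀ s)
    (α : ℝ) (hα : 0 < α)
    (μ : Measure (stairExtremal (lebesgueOn X) α)) (hμ : IsStairMaximizer s p μ)
    (hsymm : μ.map stairSwapE = μ) :
    (∃ c : ℝ, ∀ᵐ r ∂μ, stairInfoSym s p r.1 = c) ∧
    (∃ m : ℝ,
      IsGreatest (Set.range (fun r : StairBox (lebesgueOn X) α => stairInfoSym s p r)) m ∧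
      IsGreatest (privateFisherInfos α Θ P θ₀) (2 / (Real.exp α + 1) * m) ∧
      IsGreatest (stairObjectives (lebesgueOn X) α s p) (2 / (Real.exp α + 1) * m) ∧
      HasFisherInfo Θ (fun θ => stairPublicLaw μ (P θ)) θ₀ (2 / (Real.exp α + 1) * m)) ∧
    (∀ r ∈ stairExtremal (lebesgueOn X) α,
      stairInfoSym s p r =
        (Real.exp α - 1) ^ 2 * (Real.exp α + 1) / 2 *
          ((∫ x in stairLevel r, s x * p x ∂(lebesgueOn X)) ^ 2 /
            ((Real.exp α - (Real.exp α - 1) * ∫ x in stairLevel r, p x ∂(lebesgueOn X)) *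
              (1 + (Real.exp α - 1) * ∫ x in stairLevel r, p x ∂(lebesgueOn X))))) := by
  have := isBallDifferentiating_lebesgueOn hX
  exact theorem1_general (lebesgueOn X) Θ θ₀ hθ₀ P hP hPdom p hp s hs α hα.le μ hμ hsymm
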